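/- Let $\mathbf k$ be a field of characteristic $0$; all tensor products are over $\mathbf k$. **Braided structures.** A braiding on a vector space $V$ is a linear map $\sigma:V\otimes V\to V\otimes V$ with $\sigma_1\sigma_2\sigma_1=\sigma_2\sigma_1\sigma_2$ on $V^{\otimes 3}$, where $\sigma_i$ acts on the $i$-th and $(i+1)$-st tensor factors. A linear map $p:V\otimes V\to V$ is compatible with $\sigma$ if $\sigma(\mathrm{id}\otimes p)=(p\otimes \mathrm{id})\sigma_2\sigma_1$ and $\sigma(p\otimes \mathrm{id})=(\mathrm{id}\otimes p)\sigma_1\sigma_2$. A braided algebra $(A,\cdot,\sigma)$ is an associative (not necessarily unital) algebra with a braiding compatible with its product. A braided tridendriform algebra $(R,\prec,\succ,\cdot,\tau)$ is a vector space with a braiding $\tau$ and three bilinear operations, each compatible with $\tau$, such that, with $*=\prec+\succ+\,\cdot\,$, $$(x\prec y)\prec z=x\prec(y*z),\quad (x\succ y)\prec z=x\succ(y\prec z),\quad x\succ(y\succ z)=(x*y)\succ z,$$ $$(x\cdot y)\prec z=x\cdot(y\prec z),\quad (x\prec y)\cdot z=x\cdot(y\succ z),\quad (x\succ y)\cdot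 z=x\succ(y\cdot z),\quad (x\cdot y)\cdot z=x\cdot(y\cdot z).$$ Homomorphisms are the linear maps $f$ that preserve the operations and satisfy $(f\otimes f)\sigma=\sigma'(f\otimes f)$. **Lush trees.** Consider planar rooted trees all of whose internal vertices have at least two branches. A tree with $n+1$ leaves has $n$ angles; $|$ is the tree with $n=0$. Every other tree with angles decorated by a set is uniquely of the form $T=T_0\vee_{a_1}T_1\vee_{a_2}\cdots\vee_{a_k}T_k$, $k\ge 1$, with branches $T_0,\dots,T_k$ at its lowest vertex, separated by angles decorated $a_1,\dots,a_k$. A tree is lush if at each vertex a branch equal to $|$ occurs only as the leftmost or the rightmost branch. Let $\mathcal G_n$ be the set of undecorated lush trees with $n$ angles. Let $(A,\cdot,\sigma)$ be a braided algebra, and let $\overline{\mathcal P_A(A)}=\bigoplus_{n\ge1}\mathbf k\mathcal G_n\otimes A^{\otimes n}$. Write $(T;a_1,\dots,a_n)=T\otimes(a_1\otimes\cdots\otimes a_n)$ for $T$ with its angles decorated by $a_1,\dots,a_n$ from left to right. Define $\sigma_{AT}$ on $\overline{\mathcal P_A(A)}$ by $$\sigma_{AT}\big((T\otimes x)\otimes(T'\otimes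 y)\big)=(T'\otimes T)\,\beta_{mn}(x\otimes y),\qquad T\in\mathcal G_m,\ T'\in\mathcal G_n,\ x\in A^{\otimes m},\ y\in A^{\otimes n},$$ where $\beta_{mn}=(\sigma_n\cdots\sigma_1)(\sigma_{n+1}\cdots\sigma_2)\cdots(\sigma_{m+n-1}\cdots\sigma_m):A^{\otimes m}\otimes A^{\otimes n}\to A^{\otimes n}\otimes A^{\otimes m}$. Define bilinear operations recursively on decorated lush trees $T=T_0\vee_{a_1}\cdots\vee_{a_k}T_k$ and $T'=T'_0\vee_{b_1}\cdots\vee_{b_l}T'_l$ by $$T\prec_\sigma T'=T_0\vee_{a_1}\cdots\vee_{a_k}(T_k*_\sigma T'),\qquad T\succ_\sigma T'=(T*_\sigma T'_0)\vee_{b_1}\cdots\vee_{b_l}T'_l,$$ $$T\cdot_\sigma T'=\begin{cases}T_0\vee_{a_1}\cdots\vee_{a_kb_1}\cdots\vee_{b_l}T'_l,&\text{if } T_k=T'_0=|,\\ T_0\vee_{a_1}\cdots\vee_{a_k}(T_k*_\sigma T'_0)\vee_{b_1}\cdots\vee_{b_l}T'_l,&\text{otherwise,}\end{cases}$$ where $*_\sigma=\prec_\sigma+\succ_\sigma+\,\cdot_\sigma$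 and $|$ is the unit of $*_\sigma$. Let $j_A:A\to\overline{\mathcal P_A(A)}$, $j_A(a)=|\vee_a|$. **Theorem.** $(\overline{\mathcal P_A(A)},\prec_\sigma,\succ_\sigma,\cdot_\sigma,\sigma_{AT})$ is the free braided tridendriform algebra on the braided algebra $(A,\cdot,\sigma)$. That is, it is a braided tridendriform algebra; $j_A$ is an injective homomorphism of braided algebras $(A,\cdot,\sigma)\to(\overline{\mathcal P_A(A)},\cdot_\sigma,\sigma_{AT})$; and for every braided tridendriform algebra $(R,\prec_R,\succ_R,\cdot_R,\tau)$ and every homomorphism of braided algebras $\psi:(A,\cdot,\sigma)\to(R,\cdot_R,\tau)$ there is a unique homomorphism of braided tridendriform algebras $\hat\psi:\overline{\mathcal P_A(A)}\to R$ with $\psi=\hat\psi\circ j_A$. -/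

import Mathlib

open scoped TensorProduct

universe u v w

namespace BraidedTridend

/-! ### Planar rooted trees with decorated angles, and lush trees -/

mutual
/-- Planar rooted trees whose internal vertices have at least two branches and whose angles are
decorated by `X`: the trivial tree `|`, and the trees `T₀ ∨_{x₁} T₁ ∨_{x₂} ⋯ ∨_{x_k} T_k`, `k ≥ 1`,
coded as `node T₀ x₁ M T_k` where `M` lists `(T₁, x₂), …, (T_{k-1}, x_k)`. -/
inductive PTree (X : Type u) : Type u
  | leaf : PTree X
  | node : PTree X → X → Mid X → PTree X → PTree X
/-- Lists `(T₁, x₂), …, (T_{k-1}, x_k)` of inner branches, each with the angle on its right. -/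
inductive Mid (X : Type u) : Type u
  | nil : Mid X
  | cons : PTree X → X → Mid X → Mid X
end

/-- Concatenation of lists of inner branches. -/
def Mid.append {X : Type u} : Mid X → Mid X → Mid X
  | .nil, N => N
  | .cons T x M, N => .cons T x (M.append N)

mutual
/-- The decorations of the angles, from left to right. A tree with `n + 1` leaves has `n` angles. -/
def PTree.angles {X : Type u} : PTree X → List X
  | .leaf => []
  | .node S x M T => S.angles ++ x :: (M.angles ++ T.angles)
def Mid.angles {X : Type u} : Mid X → List X
  | .nil => []
  | .cons T x M => T.angles ++ x :: M.angles
end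

mutual
/-- Relabelling of the angles. -/
def PTree.map {X : Type u} {Y : Type v} (f : X → Y) : PTree X → PTree Y
  | .leaf => .leaf
  | .node S x M T => .node (S.map f) (f x) (M.map f) (T.map f)
def Mid.map {X : Type u} {Y : Type v} (f : X → Y) : Mid X → Mid Y
  | .nil => .nil
  | .cons T x M => .cons (T.map f) (f x) (M.map f)
end

mutual
/-- A tree is lush if, at every vertex, a leaf branch occurs only leftmost or rightmost. -/
def PTree.Lush {X : Type u} : PTree X → Prop
  | .leaf => True
  | .node S _ M T => S.Lush ∧ M.Lush ∧ T.Lush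
def Mid.Lush {X : Type u} : Mid X → Prop
  | .nil => True
  | .cons T _ M => T ≠ .leaf ∧ T.Lush ∧ M.Lush
end

/-- The underlying undecorated tree. -/
def PTree.shape {X : Type u} (T : PTree X) : PTree Unit := T.map fun _ => ()

/-- The leaf degree: the number of angles, which is the number of leaves minus one. -/
def PTree.deg {X : Type u} (T : PTree X) : ℕ := T.angles.length

/-! ### The products of decorated lush trees

The decorations are multiplied by `μ : X → X → X`. A product of two trees is a formal sum of
trees, written as a list. -/

section Products

variable {X : Type u} (μ : X → X → X)

/-- For the decoration `x` followed by the inner branches `M`, multiplies the last decoration by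
`y` on the right and then appends `N`. -/
def Mid.merge : X → Mid X → X → Mid X → X × Mid X
  | x, .nil, y, N => (μ x y, N)
  | x, .cons T z M, y, N => (x, .cons T (Mid.merge z M y N).1 (Mid.merge z M y N).2)

/-- `T₀ ∨_{x₁} ⋯ ∨_{x_k y_1} ⋯ ∨_{y_l} T'_l`. -/
def mergeNode (a : PTree X) (x : X) (M : Mid X) (y : X) (N : Mid X) (d : PTree X) : PTree X :=
  .node a (Mid.merge μ x M y N).1 (Mid.merge μ x M y N).2 d

/-- The trees of the middle product of `a ∨_x M ∨ b` and `c ∨_y N ∨ d`, where `L` lists the trees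
of `b * c`: the adjacent decorations are merged if `b = c = |`, and otherwise `b * c` is grafted
between them. -/
def glue (a : PTree X) (x : X) (M : Mid X) (L : List (PTree X)) (y : X) (N : Mid X) (d : PTree X) :
    PTree X → PTree X → List (PTree X)
  | .leaf, .leaf => [mergeNode μ a x M y N d]
  | _, _ => L.map fun U => .node a x (M.append (.cons U y N)) d

/-- The product `* = ≺ + ≻ + ·`, with unit `|`; the three summands are `precL`, `succL`, `dotL`. -/
def star : PTree X → PTree X → List (PTree X)
  | .leaf, t => [t]
  | .node a x M b, .leaf => [.node a x M b]
  | .node a x M b, .node c y N d =>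
      (star b (.node c y N d)).map (fun U => .node a x M U)
      ++ (star (.node a x M b) c).map (fun U => .node U y N d)
      ++ glue μ a x M (star b c) y N d b c
  termination_by s t => sizeOf s + sizeOf t

/-- `| ≺ T' = 0`, `T ≺ | = T` and `T ≺ T' = T₀ ∨_{x₁} ⋯ ∨_{x_k} (T_k * T')`. -/
def precL : PTree X → PTree X → List (PTree X)
  | .leaf, _ => []
  | .node a x M b, .leaf => [.node a x M b]
  | .node a x M b, .node c y N d => (star μ b (.node c y N d)).map fun U => .node a x M U

/-- `T ≻ | = 0`, `| ≻ T' = T'` and `T ≻ T' = (T * T'₀) ∨_{y₁} ⋯ ∨_{y_l} T'_l`. -/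
def succL : PTree X → PTree X → List (PTree X)
  | _, .leaf => []
  | .leaf, .node c y N d => [.node c y N d]
  | .node a x M b, .node c y N d => (star μ (.node a x M b) c).map fun U => .node U y N d

/-- `T · | = | · T' = 0`; `T · T' = T₀ ∨_{x₁} ⋯ ∨_{x_k y₁} ⋯ ∨_{y_l} T'_l` if `T_k = T'₀ = |`, and
`T · T' = T₀ ∨_{x₁} ⋯ ∨_{x_k} (T_k * T'₀) ∨_{y₁} ⋯ ∨_{y_l} T'_l` otherwise. -/
def dotL : PTree X → PTree X → List (PTree X)
  | .leaf, _ => []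
  | .node _ _ _ _, .leaf => []
  | .node a x M b, .node c y N d => glue μ a x M (star μ b c) y N d b c

theorem star_leaf_left (t : PTree X) : star μ .leaf t = [t] := by simp [star]

theorem star_leaf_right (t : PTree X) : star μ t .leaf = [t] := by cases t <;> simp [star]

theorem star_eq {s t : PTree X} (hs : s ≠ .leaf) (ht : t ≠ .leaf) :
    star μ s t = precL μ s t ++ succL μ s t ++ dotL μ s t := by
  cases s with
  | leaf => exact absurd rfl hs
  | node a x M b => cases t with
    | leaf => exact absurd rfl ht
    | node c y N d => rw [star, precL, succL, dotL]

/-! Lushness is preserved. -/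

theorem Mid.lush_append {M N : Mid X} (hM : M.Lush) (hN : N.Lush) : (M.append N).Lush := by
  match M, hM with
  | .nil, _ => simpa [Mid.append] using hN
  | .cons T x M, hM =>
    rw [Mid.Lush] at hM
    rw [Mid.append, Mid.Lush]
    exact ⟨hM.1, hM.2.1, Mid.lush_append hM.2.2 hN⟩

theorem Mid.lush_merge (x : X) {M : Mid X} (y : X) {N : Mid X} (hM : M.Lush) (hN : N.Lush) :
    (Mid.merge μ x M y N).2.Lush := by
  match M, hM with
  | .nil, _ => simpa [Mid.merge] using hN
  | .cons T z M, hM =>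
    rw [Mid.Lush] at hM
    rw [Mid.merge, Mid.Lush]
    exact ⟨hM.1, hM.2.1, Mid.lush_merge z y hM.2.2 hN⟩

theorem lush_glue {a b c d : PTree X} {x y : X} {M N : Mid X} {L : List (PTree X)}
    (hs : (PTree.node a x M b).Lush) (ht : (PTree.node c y N d).Lush)
    (hL : ∀ U ∈ L, U.Lush ∧ (¬ (b = .leaf ∧ c = .leaf) → U ≠ .leaf)) :
    ∀ U ∈ glue μ a x M L y N d b c, U.Lush ∧ U ≠ .leaf := by
  rw [PTree.Lush] at hs ht
  intro U hU
  unfold glue at hU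
  split at hU
  · rw [List.mem_singleton] at hU
    subst hU
    rw [mergeNode, PTree.Lush]
    exact ⟨⟨hs.1, Mid.lush_merge μ x y hs.2.1 ht.2.1, ht.2.2⟩, by simp⟩
  · rename_i hbc
    obtain ⟨V, hV, rfl⟩ := List.mem_map.1 hU
    obtain ⟨h1, h2⟩ := hL V hV
    have h3 : (Mid.cons V y N).Lush := by
      rw [Mid.Lush]
      exact ⟨h2 (fun h => hbc h.1 h.2), h1, ht.2.1⟩
    rw [PTree.Lush]
    exact ⟨⟨hs.1, Mid.lush_append hs.2.1 h3, ht.2.2⟩, by simp⟩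

theorem lush_star {s t : PTree X} (hs : s.Lush) (ht : t.Lush) :
    ∀ U ∈ star μ s t, U.Lush ∧ (¬ (s = .leaf ∧ t = .leaf) → U ≠ .leaf) := by
  match s, t, hs, ht with
  | .leaf, t, hs, ht =>
    intro U hU
    rw [star_leaf_left, List.mem_singleton] at hU
    subst hU
    exact ⟨ht, fun h h1 => h ⟨rfl, h1⟩⟩
  | .node a x M b, .leaf, hs, ht =>
    intro U hU
    rw [star_leaf_right, List.mem_singleton] at hU
    subst hU
    exact ⟨hs, fun _ => by simp⟩
  | .node a x M b, .node c y N d, hs, ht =>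
    have hs' := hs
    have ht' := ht
    rw [PTree.Lush] at hs' ht'
    intro U hU
    rw [star, List.mem_append, List.mem_append, List.mem_map, List.mem_map] at hU
    rcases hU with (⟨V, hV, rfl⟩ | ⟨V, hV, rfl⟩) | hU
    · have := lush_star hs'.2.2 ht V hV
      exact ⟨by rw [PTree.Lush]; exact ⟨hs'.1, hs'.2.1, this.1⟩, fun _ => by simp⟩
    · have := lush_star hs ht'.1 V hV
      exact ⟨by rw [PTree.Lush]; exact ⟨this.1, ht'.2.1, ht'.2.2⟩, fun _ => by simp⟩
    · have := lush_glue μ hs ht (lush_star hs'.2.2 ht'.1) U hU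
      exact ⟨this.1, fun _ => this.2⟩
  termination_by sizeOf s + sizeOf t

end Products

/-- The lush trees other than `|`, with angles decorated by `X`. -/
abbrev LushTree (X : Type u) : Type u := {T : PTree X // T.Lush ∧ T ≠ .leaf}

section LushProducts

variable {X : Type u} (μ : X → X → X)

theorem lush_precL {s t : PTree X} (hs : s.Lush ∧ s ≠ .leaf) (ht : t.Lush ∧ t ≠ .leaf) :
    ∀ U ∈ precL μ s t, U.Lush ∧ U ≠ .leaf := fun U hU =>
  have h : U ∈ star μ s t := by
    rw [star_eq μ hs.2 ht.2]
    simp [hU]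
  ⟨(lush_star μ hs.1 ht.1 U h).1, (lush_star μ hs.1 ht.1 U h).2 fun h => hs.2 h.1⟩

theorem lush_succL {s t : PTree X} (hs : s.Lush ∧ s ≠ .leaf) (ht : t.Lush ∧ t ≠ .leaf) :
    ∀ U ∈ succL μ s t, U.Lush ∧ U ≠ .leaf := fun U hU =>
  have h : U ∈ star μ s t := by
    rw [star_eq μ hs.2 ht.2]
    simp [hU]
  ⟨(lush_star μ hs.1 ht.1 U h).1, (lush_star μ hs.1 ht.1 U h).2 fun h => hs.2 h.1⟩

theorem lush_dotL {s t : PTree X} (hs : s.Lush ∧ s ≠ .leaf) (ht : t.Lush ∧ t ≠ .leaf) :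
    ∀ U ∈ dotL μ s t, U.Lush ∧ U ≠ .leaf := fun U hU =>
  have h : U ∈ star μ s t := by
    rw [star_eq μ hs.2 ht.2]
    simp [hU]
  ⟨(lush_star μ hs.1 ht.1 U h).1, (lush_star μ hs.1 ht.1 U h).2 fun h => hs.2 h.1⟩

/-- `s ≺ t` as a formal sum of lush trees. -/
def LushTree.prec (s t : LushTree X) : List (LushTree X) :=
  (precL μ s.1 t.1).attachWith _ (lush_precL μ s.2 t.2)

/-- `s ≻ t` as a formal sum of lush trees. -/
def LushTree.succ (s t : LushTree X) : List (LushTree X) :=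
  (succL μ s.1 t.1).attachWith _ (lush_succL μ s.2 t.2)

/-- `s · t` as a formal sum of lush trees. -/
def LushTree.dot (s t : LushTree X) : List (LushTree X) :=
  (dotL μ s.1 t.1).attachWith _ (lush_dotL μ s.2 t.2)

theorem PTree.lush_map {Y : Type v} (f : X → Y) (T : PTree X) : (T.map f).Lush ↔ T.Lush := by
  refine PTree.rec (motive_1 := fun T : PTree X => (T.map f).Lush ↔ T.Lush)
    (motive_2 := fun M : Mid X => (M.map f).Lush ↔ M.Lush) ?_ ?_ ?_ ?_ T
  · simp [PTree.map, PTree.Lush]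
  · intro a x M b ha hM hb
    simp [PTree.map, PTree.Lush, ha, hM, hb]
  · simp [Mid.map, Mid.Lush]
  · intro a x M ha hM
    cases a <;> simp_all [Mid.map, Mid.Lush, PTree.map]

theorem PTree.map_ne_leaf {Y : Type v} (f : X → Y) (T : PTree X) : T.map f ≠ .leaf ↔ T ≠ .leaf := by
  cases T <;> simp [PTree.map]

theorem PTree.angles_map {Y : Type v} (f : X → Y) (T : PTree X) :
    (T.map f).angles = T.angles.map f := by
  refine PTree.rec (motive_1 := fun T : PTree X => (T.map f).angles = T.angles.map f)
    (motive_2 := fun M : Mid X => (M.map f).angles = M.angles.map f) ?_ ?_ ?_ ?_ T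
  · simp [PTree.map, PTree.angles]
  · intro a x M b ha hM hb
    simp [PTree.map, PTree.angles, ha, hM, hb]
  · simp [Mid.map, Mid.angles]
  · intro a x M ha hM
    simp [Mid.map, Mid.angles, ha, hM]

theorem PTree.deg_shape (T : PTree X) : T.shape.deg = T.deg := by
  simp [PTree.deg, PTree.shape, PTree.angles_map]

/-- The underlying undecorated lush tree. -/
def LushTree.shape (T : LushTree X) : LushTree Unit :=
  ⟨T.1.shape, (PTree.lush_map _ _).2 T.2.1, (PTree.map_ne_leaf _ _).2 T.2.2⟩

/-- The number of angles. -/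
def LushTree.deg (T : LushTree X) : ℕ := T.1.deg

/-- The tree with one vertex and two leaves, its angle decorated by `x`. -/
def LushTree.single (x : X) : LushTree X :=
  ⟨.node .leaf x .nil .leaf, by simp [PTree.Lush, Mid.Lush], by simp⟩

end LushProducts

/-! ### Braidings, braided algebras and braided tridendriform algebras -/

section Structures

variable {k : Type u} [CommRing k] {V : Type v} [AddCommGroup V] [Module k V]

/-- `σ₁ = σ ⊗ id` on `V ⊗ V ⊗ V`. -/
noncomputable def sigmaOne (σ : V ⊗[k] V →ₗ[k] V ⊗[k] V) :
    V ⊗[k] (V ⊗[k] V) →ₗ[k] V ⊗[k] (V ⊗[k] V) :=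
  (TensorProduct.assoc k V V V).toLinearMap ∘ₗ σ.rTensor V ∘ₗ
    (TensorProduct.assoc k V V V).symm.toLinearMap

/-- `σ₂ = id ⊗ σ` on `V ⊗ V ⊗ V`. -/
noncomputable def sigmaTwo (σ : V ⊗[k] V →ₗ[k] V ⊗[k] V) :
    V ⊗[k] (V ⊗[k] V) →ₗ[k] V ⊗[k] (V ⊗[k] V) := σ.lTensor V

/-- The braid relation `σ₁ σ₂ σ₁ = σ₂ σ₁ σ₂`. -/
def IsBraiding (σ : V ⊗[k] V →ₗ[k] V ⊗[k] V) : Prop :=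
  sigmaOne σ ∘ₗ sigmaTwo σ ∘ₗ sigmaOne σ = sigmaTwo σ ∘ₗ sigmaOne σ ∘ₗ sigmaTwo σ

/-- `σ (id ⊗ p) = (p ⊗ id) σ₂ σ₁` and `σ (p ⊗ id) = (id ⊗ p) σ₁ σ₂`. -/
def IsBraidedOp (p : V ⊗[k] V →ₗ[k] V) (σ : V ⊗[k] V →ₗ[k] V ⊗[k] V) : Prop :=
  σ ∘ₗ p.lTensor V = (p.rTensor V ∘ₗ (TensorProduct.assoc k V V V).symm.toLinearMap) ∘ₗ
    sigmaTwo σ ∘ₗ sigmaOne σ ∧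
  σ ∘ₗ (p.rTensor V ∘ₗ (TensorProduct.assoc k V V V).symm.toLinearMap) =
    p.lTensor V ∘ₗ sigmaOne σ ∘ₗ sigmaTwo σ

/-- A braided algebra: associative, not necessarily unital or commutative. -/
structure IsBraidedAlgebra (μ : V ⊗[k] V →ₗ[k] V) (σ : V ⊗[k] V →ₗ[k] V ⊗[k] V) : Prop where
  assoc : ∀ x y z : V, μ (μ (x ⊗ₜ y) ⊗ₜ z) = μ (x ⊗ₜ μ (y ⊗ₜ z))
  braiding : IsBraiding σ
  compat : IsBraidedOp μ σ

structure IsTridendriform (prec succ dot : V ⊗[k] V →ₗ[k] V) : Prop where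
  prec_prec : ∀ x y z : V, prec (prec (x ⊗ₜ y) ⊗ₜ z) = prec (x ⊗ₜ (prec + succ + dot) (y ⊗ₜ z))
  succ_prec : ∀ x y z : V, prec (succ (x ⊗ₜ y) ⊗ₜ z) = succ (x ⊗ₜ prec (y ⊗ₜ z))
  succ_succ : ∀ x y z : V, succ (x ⊗ₜ succ (y ⊗ₜ z)) = succ ((prec + succ + dot) (x ⊗ₜ y) ⊗ₜ z)
  dot_prec : ∀ x y z : V, prec (dot (x ⊗ₜ y) ⊗ₜ z) = dot (x ⊗ₜ prec (y ⊗ₜ z))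
  prec_dot : ∀ x y z : V, dot (prec (x ⊗ₜ y) ⊗ₜ z) = dot (x ⊗ₜ succ (y ⊗ₜ z))
  succ_dot : ∀ x y z : V, dot (succ (x ⊗ₜ y) ⊗ₜ z) = succ (x ⊗ₜ dot (y ⊗ₜ z))
  dot_dot : ∀ x y z : V, dot (dot (x ⊗ₜ y) ⊗ₜ z) = dot (x ⊗ₜ dot (y ⊗ₜ z))

structure IsBraidedTridendriform (prec succ dot : V ⊗[k] V →ₗ[k] V)
    (σ : V ⊗[k] V →ₗ[k] V ⊗[k] V) : Prop where
  tridendriform : IsTridendriform prec succ dot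
  braiding : IsBraiding σ
  compat_prec : IsBraidedOp prec σ
  compat_succ : IsBraidedOp succ σ
  compat_dot : IsBraidedOp dot σ

variable {W : Type w} [AddCommGroup W] [Module k W]

/-- `f (x y) = f x f y`, that is, `f p = p' (f ⊗ f)`. -/
def PreservesOp (p : V ⊗[k] V →ₗ[k] V) (p' : W ⊗[k] W →ₗ[k] W) (f : V →ₗ[k] W) : Prop :=
  f ∘ₗ p = p' ∘ₗ TensorProduct.map f f

/-- `(f ⊗ f) σ = σ' (f ⊗ f)`. -/
def PreservesBraiding (σ : V ⊗[k] V →ₗ[k] V ⊗[k] V) (σ' : W ⊗[k] W →ₗ[k] W ⊗[k] W)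
    (f : V →ₗ[k] W) : Prop :=
  TensorProduct.map f f ∘ₗ σ = σ' ∘ₗ TensorProduct.map f f

structure IsBraidedAlgebraHom (μ : V ⊗[k] V →ₗ[k] V) (σ : V ⊗[k] V →ₗ[k] V ⊗[k] V)
    (μ' : W ⊗[k] W →ₗ[k] W) (σ' : W ⊗[k] W →ₗ[k] W ⊗[k] W) (f : V →ₗ[k] W) : Prop where
  map_mul : PreservesOp μ μ' f
  map_braiding : PreservesBraiding σ σ' f

structure IsBraidedTridendriformHom (prec succ dot : V ⊗[k] V →ₗ[k] V)
    (σ : V ⊗[k] V →ₗ[k] V ⊗[k] V) (prec' succ' dot' : W ⊗[k] W →ₗ[k] W)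
    (σ' : W ⊗[k] W →ₗ[k] W ⊗[k] W) (f : V →ₗ[k] W) : Prop where
  map_prec : PreservesOp prec prec' f
  map_succ : PreservesOp succ succ' f
  map_dot : PreservesOp dot dot' f
  map_braiding : PreservesBraiding σ σ' f

end Structures

/-! ### Operators on tensor powers -/

section TensorPowers

open PiTensorProduct

variable {k : Type u} [CommRing k] {A : Type v} [AddCommGroup A] [Module k A]

/-- `A ≃ A^{⊗1}`. -/
noncomputable def oneEquiv : A ≃ₗ[k] ⨂[k]^1 A :=
  (PiTensorProduct.subsingletonEquiv (R := k) (s := fun _ : Fin 1 => A) 0).symm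

/-- `A ⊗ A ≃ A^{⊗2}`. -/
noncomputable def twoEquiv : A ⊗[k] A ≃ₗ[k] ⨂[k]^2 A :=
  (TensorProduct.congr oneEquiv oneEquiv).trans (TensorPower.mulEquiv (n := 1) (m := 1))

/-- `id^{⊗i} ⊗ f ⊗ id^{⊗r}`, for `f : A ⊗ A → A^{⊗j}`. -/
noncomputable def opAt {j : ℕ} (f : A ⊗[k] A →ₗ[k] ⨂[k]^j A) (i r : ℕ) :
    ⨂[k]^(i + 2 + r) A →ₗ[k] ⨂[k]^(i + j + r) A :=
  TensorPower.mulEquiv.toLinearMap ∘ₗ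
    (TensorPower.mulEquiv.toLinearMap ∘ₗ
      (f ∘ₗ twoEquiv.symm.toLinearMap).lTensor _ ∘ₗ
        TensorPower.mulEquiv.symm.toLinearMap).rTensor _ ∘ₗ
    TensorPower.mulEquiv.symm.toLinearMap

/-- `σ` acting on the tensor factors `i` and `i + 1` of `A^{⊗N}`, counted from `0`. -/
noncomputable def sigmaAt (σ : A ⊗[k] A →ₗ[k] A ⊗[k] A) (N i : ℕ) : Module.End k (⨂[k]^N A) :=
  if h : i + 2 + (N - i - 2) = N then
    (TensorPower.cast k A h).toLinearMap ∘ₗ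
      opAt (twoEquiv.toLinearMap ∘ₗ σ) i (N - i - 2) ∘ₗ (TensorPower.cast k A h.symm).toLinearMap
  else 0

/-- `σ_{i+n-1} ⋯ σ_{i+1} σ_i`, moving the factor `i` to the right past `n` factors. -/
noncomputable def sigmaRow (σ : A ⊗[k] A →ₗ[k] A ⊗[k] A) (N n i : ℕ) : Module.End k (⨂[k]^N A) :=
  ((List.range n).reverse.map fun j => sigmaAt σ N (i + j)).prod

/-- The lift of the permutation that moves the first `m` factors past the last `n`, through the
reduced expression `(σ_{n-1} ⋯ σ_0) (σ_n ⋯ σ_1) ⋯ (σ_{m+n-2} ⋯ σ_{m-1})`. -/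
noncomputable def betaWord (σ : A ⊗[k] A →ₗ[k] A ⊗[k] A) (m n : ℕ) :
    Module.End k (⨂[k]^(m + n) A) :=
  ((List.range m).map fun i => sigmaRow σ (m + n) n i).prod

/-- `β_{m n} : A^{⊗m} ⊗ A^{⊗n} → A^{⊗n} ⊗ A^{⊗m}`. -/
noncomputable def beta (σ : A ⊗[k] A →ₗ[k] A ⊗[k] A) (m n : ℕ) :
    ⨂[k]^m A ⊗[k] ⨂[k]^n A →ₗ[k] ⨂[k]^n A ⊗[k] ⨂[k]^m A :=
  TensorPower.mulEquiv.symm.toLinearMap ∘ₗ (TensorPower.cast k A (Nat.add_comm m n)).toLinearMap ∘ₗ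
    betaWord σ m n ∘ₗ TensorPower.mulEquiv.toLinearMap

/-- The way in which the decorations of two trees with `m` and `n` angles decorate a tree with `p`
angles in one of their products: concatenation if `p = m + n`, and if `p + 1 = m + n`,
`(a₁ ⊗ ⋯ ⊗ a_m) ⊗ (b₁ ⊗ ⋯ ⊗ b_n) ↦ a₁ ⊗ ⋯ ⊗ a_m b₁ ⊗ ⋯ ⊗ b_n`. No other `p` occurs. -/
noncomputable def join (μ : A ⊗[k] A →ₗ[k] A) (m n p : ℕ) :
    ⨂[k]^m A ⊗[k] ⨂[k]^n A →ₗ[k] ⨂[k]^p A :=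
  if h : m + n = p then (TensorPower.cast k A h).toLinearMap ∘ₗ TensorPower.mulEquiv.toLinearMap
  else if h : m + n = m - 1 + 2 + (n - 1) ∧ m - 1 + 1 + (n - 1) = p then
    (TensorPower.cast k A h.2).toLinearMap ∘ₗ
      opAt (oneEquiv.toLinearMap ∘ₗ μ) (m - 1) (n - 1) ∘ₗ
      (TensorPower.cast k A h.1).toLinearMap ∘ₗ TensorPower.mulEquiv.toLinearMap
  else 0

/-- `a₁ ⊗ ⋯ ⊗ a_n`, for a list `l = [a₁, …, a_n]`. -/
noncomputable def listTensor (n : ℕ) (l : List A) (h : l.length = n) : ⨂[k]^n A :=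
  TensorPower.cast k A h (PiTensorProduct.tprod k l.get)

theorem cast_listTensor {m n : ℕ} (h : m = n) (l : List A) (hl : l.length = m) :
    TensorPower.cast k A h (listTensor m l hl) = listTensor n l (hl.trans h) := by
  simp [listTensor]

theorem mulEquiv_listTensor {m n : ℕ} (l l' : List A) (h : l.length = m) (h' : l'.length = n) :
    TensorPower.mulEquiv (listTensor (k := k) m l h ⊗ₜ listTensor n l' h') =
      listTensor (m + n) (l ++ l') (by simp [h, h']) := by
  subst h h'
  rw [listTensor, listTensor, listTensor, TensorPower.cast_tprod, TensorPower.cast_tprod,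
    TensorPower.cast_tprod, ← TensorPower.gMul_def, TensorPower.tprod_mul_tprod]
  congr 1
  funext i
  refine Fin.addCases (fun i => ?_) (fun i => ?_) i <;> simp

theorem oneEquiv_apply (a : A) : oneEquiv (k := k) a = listTensor 1 [a] rfl := by
  rw [oneEquiv, PiTensorProduct.subsingletonEquiv_symm_apply', listTensor, TensorPower.cast_tprod]
  congr 1
  funext i
  fin_cases i
  rfl

theorem twoEquiv_apply (a b : A) : twoEquiv (k := k) (a ⊗ₜ b) = listTensor 2 [a, b] rfl := by
  rw [twoEquiv, LinearEquiv.trans_apply, TensorProduct.congr_tmul, oneEquiv_apply, oneEquiv_apply]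
  exact mulEquiv_listTensor [a] [b] rfl rfl

theorem opAt_listTensor {j : ℕ} (f : A ⊗[k] A →ₗ[k] ⨂[k]^j A) (p q : List A) (a b : A) (c : List A)
    (hc : c.length = j) (hf : f (a ⊗ₜ b) = listTensor j c hc) {i r : ℕ} (hp : p.length = i)
    (hq : q.length = r) :
    opAt f i r (listTensor (i + 2 + r) (p ++ [a, b] ++ q) (by simp [hp, hq]; omega)) =
      listTensor (i + j + r) (p ++ c ++ q) (by simp [hp, hq, hc]; omega) := by
  rw [← mulEquiv_listTensor (p ++ [a, b]) q (by simp [hp]) hq,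
    show listTensor (k := k) (i + 2) (p ++ [a, b]) (by simp [hp]) = _ from
      (mulEquiv_listTensor (n := 2) p [a, b] hp rfl).symm, ← twoEquiv_apply,
    ← mulEquiv_listTensor (p ++ c) q (by simp [hp, hc]) hq,
    ← mulEquiv_listTensor p c hp hc, ← hf]
  simp [opAt]

/-- `l₃` is the concatenation of `l₁` and `l₂`, or is obtained from it by multiplying the last entry
of `l₁` with the first entry of `l₂`. -/
def Joins {X : Type w} (μ : X → X → X) (l₁ l₂ l₃ : List X) : Prop :=
  l₃ = l₁ ++ l₂ ∨ ∃ p a b q, l₁ = p ++ [a] ∧ l₂ = b :: q ∧ l₃ = p ++ μ a b :: q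

theorem join_listTensor (μ : A ⊗[k] A →ₗ[k] A) {l₁ l₂ l₃ : List A}
    (h : Joins (fun a b => μ (a ⊗ₜ b)) l₁ l₂ l₃) {m n r : ℕ} (h₁ : l₁.length = m)
    (h₂ : l₂.length = n) (h₃ : l₃.length = r) :
    join μ m n r (listTensor m l₁ h₁ ⊗ₜ listTensor n l₂ h₂) = listTensor r l₃ h₃ := by
  rcases h with rfl | ⟨p, a, b, q, rfl, rfl, rfl⟩
  · have : m + n = r := by simp [← h₁, ← h₂, ← h₃]
    simp [join, this, mulEquiv_listTensor, cast_listTensor]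
  · simp only [List.length_append, List.length_cons, List.length_nil] at h₁ h₂ h₃
    have e₁ : ¬ m + n = r := by omega
    have e₂ : m + n = m - 1 + 2 + (n - 1) ∧ m - 1 + 1 + (n - 1) = r := by omega
    have e₃ := opAt_listTensor (oneEquiv.toLinearMap ∘ₗ μ) p q a b [μ (a ⊗ₜ b)] rfl
      (by simp [oneEquiv_apply]) (i := m - 1) (r := n - 1) (by omega) (by omega)
    simp only [List.append_assoc, List.cons_append, List.nil_append] at e₃
    rw [join, dif_neg e₁, dif_pos e₂]
    simp only [LinearMap.comp_apply, LinearEquiv.coe_coe, mulEquiv_listTensor, cast_listTensor,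
      List.append_assoc, List.cons_append, List.nil_append, e₃]

end TensorPowers

section Naturality

variable {X : Type u} (μ : X → X → X)

theorem Joins.context {μ : X → X → X} {l₁ l₂ l₃ : List X} (h : Joins μ l₁ l₂ l₃) (c d : List X) :
    Joins μ (c ++ l₁) (l₂ ++ d) (c ++ l₃ ++ d) := by
  rcases h with rfl | ⟨p, a, b, q, rfl, rfl, rfl⟩
  · exact Or.inl (by simp)
  · exact Or.inr ⟨c ++ p, a, b, q ++ d, by simp, by simp, by simp⟩

theorem Mid.angles_append (M N : Mid X) : (M.append N).angles = M.angles ++ N.angles := by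
  match M with
  | .nil => simp [Mid.append, Mid.angles]
  | .cons T x M => simp [Mid.append, Mid.angles, Mid.angles_append M N]

theorem Mid.map_append {Y : Type v} (f : X → Y) (M N : Mid X) :
    (M.append N).map f = (M.map f).append (N.map f) := by
  match M with
  | .nil => simp [Mid.append, Mid.map]
  | .cons T x M => simp [Mid.append, Mid.map, Mid.map_append f M N]

theorem Mid.angles_merge (x : X) (M : Mid X) (y : X) (N : Mid X) :
    ∃ p a, x :: M.angles = p ++ [a] ∧
      (Mid.merge μ x M y N).1 :: (Mid.merge μ x M y N).2.angles = p ++ μ a y :: N.angles := by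
  match M with
  | .nil => exact ⟨[], x, by simp [Mid.angles], by simp [Mid.merge]⟩
  | .cons T z M =>
    obtain ⟨p, a, h₁, h₂⟩ := Mid.angles_merge z M y N
    exact ⟨x :: (T.angles ++ p), a, by simp [Mid.angles, h₁], by simp [Mid.merge, Mid.angles, h₂]⟩

theorem Mid.map_merge {Y : Type v} (f : X → Y) (ν : Y → Y → Y) (hf : ∀ a b, f (μ a b) = ν (f a) (f b))
    (x : X) (M : Mid X) (y : X) (N : Mid X) :
    f (Mid.merge μ x M y N).1 = (Mid.merge ν (f x) (M.map f) (f y) (N.map f)).1 ∧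
    (Mid.merge μ x M y N).2.map f = (Mid.merge ν (f x) (M.map f) (f y) (N.map f)).2 := by
  match M with
  | .nil => simp [Mid.merge, Mid.map, hf]
  | .cons T z M =>
    have := Mid.map_merge f ν hf z M y N
    simp [Mid.merge, Mid.map, this]

theorem joins_glue {a b c d : PTree X} {x y : X} {M N : Mid X} {L : List (PTree X)}
    (hL : ∀ U ∈ L, Joins μ b.angles c.angles U.angles) :
    ∀ U ∈ glue μ a x M L y N d b c,
      Joins μ (PTree.node a x M b).angles (PTree.node c y N d).angles U.angles := by
  intro U hU
  unfold glue at hU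
  split at hU
  · rw [List.mem_singleton] at hU
    subst hU
    obtain ⟨p, z, h₁, h₂⟩ := Mid.angles_merge μ x M y N
    refine Or.inr ⟨a.angles ++ p, z, y, N.angles ++ d.angles, ?_, ?_, ?_⟩
    · simp [PTree.angles, h₁]
    · simp [PTree.angles]
    · have := congrArg (fun l => a.angles ++ (l ++ d.angles)) h₂
      simpa [mergeNode, PTree.angles] using this
  · obtain ⟨V, hV, rfl⟩ := List.mem_map.1 hU
    have := (hL V hV).context (a.angles ++ x :: M.angles) (y :: (N.angles ++ d.angles))
    simpa [PTree.angles, Mid.angles_append, Mid.angles] using this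

theorem joins_star (s t : PTree X) :
    ∀ U ∈ star μ s t, Joins μ s.angles t.angles U.angles := by
  match s, t with
  | .leaf, t =>
    intro U hU
    rw [star_leaf_left, List.mem_singleton] at hU
    subst hU
    exact Or.inl (by simp [PTree.angles])
  | .node a x M b, .leaf =>
    intro U hU
    rw [star_leaf_right, List.mem_singleton] at hU
    subst hU
    exact Or.inl (by simp [PTree.angles])
  | .node a x M b, .node c y N d =>
    intro U hU
    rw [star, List.mem_append, List.mem_append, List.mem_map, List.mem_map] at hU
    rcases hU with (⟨V, hV, rfl⟩ | ⟨V, hV, rfl⟩) | hU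
    · have := (joins_star b (.node c y N d) V hV).context (a.angles ++ x :: M.angles) []
      simpa [PTree.angles] using this
    · have := (joins_star (.node a x M b) c V hV).context [] (y :: (N.angles ++ d.angles))
      simpa [PTree.angles] using this
    · exact joins_glue μ (joins_star b c) U hU
  termination_by sizeOf s + sizeOf t

theorem map_glue {Y : Type v} (f : X → Y) (ν : Y → Y → Y) (hf : ∀ a b, f (μ a b) = ν (f a) (f b))
    {a b c d : PTree X} {x y : X} {M N : Mid X} {L : List (PTree X)} :
    (glue μ a x M L y N d b c).map (PTree.map f) = glue ν (a.map f) (f x) (M.map f)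
      (L.map (PTree.map f)) (f y) (N.map f) (d.map f) (b.map f) (c.map f) := by
  have := Mid.map_merge μ f ν hf x M y N
  cases b <;> cases c <;>
    simp [glue, PTree.map, mergeNode, this, Mid.map, Mid.map_append, Function.comp_def]

theorem map_star {Y : Type v} (f : X → Y) (ν : Y → Y → Y) (hf : ∀ a b, f (μ a b) = ν (f a) (f b))
    (s t : PTree X) : (star μ s t).map (PTree.map f) = star ν (s.map f) (t.map f) := by
  match s, t with
  | .leaf, t => simp [star_leaf_left, PTree.map]
  | .node a x M b, .leaf => simp [star_leaf_right, PTree.map]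
  | .node a x M b, .node c y N d =>
    have h₁ := map_star f ν hf b (.node c y N d)
    have h₂ := map_star f ν hf (.node a x M b) c
    have h₃ := map_star f ν hf b c
    rw [star, List.map_append, List.map_append, map_glue μ f ν hf, h₃]
    simp only [PTree.map] at h₁ h₂ ⊢
    rw [star, ← h₁, ← h₂]
    simp [PTree.map, Function.comp_def]
  termination_by sizeOf s + sizeOf t

theorem map_precL {Y : Type v} (f : X → Y) (ν : Y → Y → Y) (hf : ∀ a b, f (μ a b) = ν (f a) (f b))
    (s t : PTree X) : (precL μ s t).map (PTree.map f) = precL ν (s.map f) (t.map f) := by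
  match s, t with
  | .leaf, t => simp [precL, PTree.map]
  | .node a x M b, .leaf => simp [precL, PTree.map]
  | .node a x M b, .node c y N d =>
    have h := map_star μ f ν hf b (.node c y N d)
    simp only [PTree.map] at h ⊢
    simp [precL, PTree.map, Function.comp_def, ← h]

theorem map_succL {Y : Type v} (f : X → Y) (ν : Y → Y → Y) (hf : ∀ a b, f (μ a b) = ν (f a) (f b))
    (s t : PTree X) : (succL μ s t).map (PTree.map f) = succL ν (s.map f) (t.map f) := by
  match s, t with
  | .leaf, .leaf => simp [succL, PTree.map]
  | .leaf, .node c y N d => simp [succL, PTree.map]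
  | .node a x M b, .leaf => simp [succL, PTree.map]
  | .node a x M b, .node c y N d =>
    have h := map_star μ f ν hf (.node a x M b) c
    simp only [PTree.map] at h ⊢
    simp [succL, PTree.map, Function.comp_def, ← h]

theorem map_dotL {Y : Type v} (f : X → Y) (ν : Y → Y → Y) (hf : ∀ a b, f (μ a b) = ν (f a) (f b))
    (s t : PTree X) : (dotL μ s t).map (PTree.map f) = dotL ν (s.map f) (t.map f) := by
  match s, t with
  | .leaf, t => simp [dotL, PTree.map]
  | .node a x M b, .leaf => simp [dotL, PTree.map]
  | .node a x M b, .node c y N d =>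
    simp only [PTree.map, dotL, map_glue μ f ν hf, map_star μ f ν hf]

end Naturality

/-! ### The space of lush trees -/

section LushSpace

variable (k : Type u) [CommRing k] (A : Type v) [AddCommGroup A] [Module k A]

noncomputable instance {X : Type w} : DecidableEq (LushTree X) := Classical.decEq _

/-- The span of the lush trees other than `|` with angles decorated multilinearly by `A`: the
direct sum, over the undecorated lush trees `T` with `n ≥ 1` angles, of `T ⊗ A^{⊗n}`. -/
abbrev LushSpace : Type (max u v) := DirectSum (LushTree Unit) fun T => ⨂[k]^(T.deg) A

/-- `x ↦ T ⊗ x`. -/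
noncomputable def incl (T : LushTree Unit) : ⨂[k]^(T.deg) A →ₗ[k] LushSpace k A :=
  DirectSum.lof k (LushTree Unit) (fun T => ⨂[k]^(T.deg) A) T

variable {k A}

/-- The element `(T; a₁, …, a_n) = T ⊗ (a₁ ⊗ ⋯ ⊗ a_n)`. -/
noncomputable def mk (T : LushTree A) : LushSpace k A :=
  incl k A T.shape (listTensor T.shape.deg T.1.angles (PTree.deg_shape T.1).symm)

/-- The linear map on `LushSpace ⊗ LushSpace` with the given components. -/
noncomputable def bilin {M : Type w} [AddCommMonoid M] [Module k M]
    (f : ∀ S T : LushTree Unit, ⨂[k]^(S.deg) A ⊗[k] ⨂[k]^(T.deg) A →ₗ[k] M) :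
    LushSpace k A ⊗[k] LushSpace k A →ₗ[k] M :=
  TensorProduct.lift <| DirectSum.toModule k _ _ fun S => LinearMap.flip <|
    DirectSum.toModule k _ _ fun T => LinearMap.flip <| TensorProduct.curry (f S T)

theorem bilin_incl {M : Type w} [AddCommMonoid M] [Module k M]
    (f : ∀ S T : LushTree Unit, ⨂[k]^(S.deg) A ⊗[k] ⨂[k]^(T.deg) A →ₗ[k] M)
    (S T : LushTree Unit) (x : ⨂[k]^(S.deg) A) (y : ⨂[k]^(T.deg) A) :
    bilin f (incl k A S x ⊗ₜ incl k A T y) = f S T (x ⊗ₜ y) := by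
  simp [bilin, incl]

/-- `∑ U ⊗ join(x, y)`, over the trees `U` of the list `op S T`, is the product of `S ⊗ x` and
`T ⊗ y`. -/
noncomputable def treeOp (μ : A ⊗[k] A →ₗ[k] A)
    (op : LushTree Unit → LushTree Unit → List (LushTree Unit)) :
    LushSpace k A ⊗[k] LushSpace k A →ₗ[k] LushSpace k A :=
  bilin fun S T => ((op S T).map fun U =>
    incl k A U ∘ₗ join μ S.deg T.deg U.deg).sum

/-- The operation `≺_σ`; see `prec_mk` for its value on decorated trees. -/
noncomputable def prec (μ : A ⊗[k] A →ₗ[k] A) :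
    LushSpace k A ⊗[k] LushSpace k A →ₗ[k] LushSpace k A :=
  treeOp μ (LushTree.prec fun _ _ => ())

/-- The operation `≻_σ`; see `succ_mk` for its value on decorated trees. -/
noncomputable def succ (μ : A ⊗[k] A →ₗ[k] A) :
    LushSpace k A ⊗[k] LushSpace k A →ₗ[k] LushSpace k A :=
  treeOp μ (LushTree.succ fun _ _ => ())

/-- The operation `·_σ`; see `dot_mk` for its value on decorated trees. -/
noncomputable def dot (μ : A ⊗[k] A →ₗ[k] A) :
    LushSpace k A ⊗[k] LushSpace k A →ₗ[k] LushSpace k A :=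
  treeOp μ (LushTree.dot fun _ _ => ())

/-- `σ_{AT}((S ⊗ x) ⊗ (T ⊗ y)) = (T ⊗ S) β_{m n}(x ⊗ y)`. -/
noncomputable def braiding (σ : A ⊗[k] A →ₗ[k] A ⊗[k] A) :
    LushSpace k A ⊗[k] LushSpace k A →ₗ[k] LushSpace k A ⊗[k] LushSpace k A :=
  bilin fun S T =>
    TensorProduct.map (incl k A T) (incl k A S) ∘ₗ beta σ S.deg T.deg

variable (k A)

/-- The embedding `a ↦ T[a]` of `A`; see `emb_apply`. -/
noncomputable def emb : A →ₗ[k] LushSpace k A :=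
  incl k A (LushTree.single ()) ∘ₗ oneEquiv.toLinearMap

variable {k A}

theorem emb_apply (a : A) : emb k A a = mk (LushTree.single a) := by
  change incl k A (LushTree.single ()) (oneEquiv a) = _
  rw [oneEquiv_apply]
  rfl

theorem treeOp_mk (μ : A ⊗[k] A →ₗ[k] A) (op : LushTree Unit → LushTree Unit → List (LushTree Unit))
    (s t : LushTree A) (L : List (LushTree A)) (hop : L.map LushTree.shape = op s.shape t.shape)
    (hL : ∀ U ∈ L, Joins (fun a b => μ (a ⊗ₜ b)) s.1.angles t.1.angles U.1.angles) :
    treeOp μ op (mk s ⊗ₜ mk t) = (L.map mk).sum := by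
  rw [treeOp, mk, mk, bilin_incl, ← hop, List.map_map]
  clear hop
  induction L with
  | nil => simp
  | cons U L ih =>
    rw [List.map_cons, List.map_cons, List.sum_cons, List.sum_cons, LinearMap.add_apply,
      ih fun V hV => hL V (List.mem_cons_of_mem _ hV)]
    congr 1
    exact congrArg (incl k A U.shape) (join_listTensor μ (hL U List.mem_cons_self) _ _
      (PTree.deg_shape U.1).symm)

theorem shape_attachWith {X : Type w} {l : List (PTree X)} {l' : List (PTree Unit)}
    (H : ∀ U ∈ l, U.Lush ∧ U ≠ .leaf) (H' : ∀ U ∈ l', U.Lush ∧ U ≠ .leaf)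
    (h : l.map PTree.shape = l') :
    (l.attachWith _ H).map LushTree.shape = l'.attachWith _ H' := by
  subst h
  refine List.map_injective_iff.2 Subtype.val_injective ?_
  rw [List.attachWith_map_subtype_val]
  refine Eq.trans ?_ (congrArg (List.map PTree.shape) (List.attachWith_map_subtype_val H))
  rw [List.map_map, List.map_map]
  rfl

theorem prec_mk (μ : A ⊗[k] A →ₗ[k] A) (s t : LushTree A) :
    prec μ (mk s ⊗ₜ mk t) = ((LushTree.prec (fun a b => μ (a ⊗ₜ b)) s t).map mk).sum := by
  refine treeOp_mk μ _ s t _ ?_ fun U hU => joins_star _ _ _ _ ?_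
  · exact shape_attachWith _ _
      (map_precL (fun a b => μ (a ⊗ₜ b)) (fun _ => ()) (fun _ _ => ()) (fun _ _ => rfl) s.1 t.1)
  · rw [star_eq _ s.2.2 t.2.2]
    have : U.1 ∈ precL (fun a b => μ (a ⊗ₜ b)) s.1 t.1 := (List.mem_attachWith _ U).1 hU
    simp [this]

theorem succ_mk (μ : A ⊗[k] A →ₗ[k] A) (s t : LushTree A) :
    succ μ (mk s ⊗ₜ mk t) = ((LushTree.succ (fun a b => μ (a ⊗ₜ b)) s t).map mk).sum := by
  refine treeOp_mk μ _ s t _ ?_ fun U hU => joins_star _ _ _ _ ?_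
  · exact shape_attachWith _ _
      (map_succL (fun a b => μ (a ⊗ₜ b)) (fun _ => ()) (fun _ _ => ()) (fun _ _ => rfl) s.1 t.1)
  · rw [star_eq _ s.2.2 t.2.2]
    have : U.1 ∈ succL (fun a b => μ (a ⊗ₜ b)) s.1 t.1 := (List.mem_attachWith _ U).1 hU
    simp [this]

theorem dot_mk (μ : A ⊗[k] A →ₗ[k] A) (s t : LushTree A) :
    dot μ (mk s ⊗ₜ mk t) = ((LushTree.dot (fun a b => μ (a ⊗ₜ b)) s t).map mk).sum := by
  refine treeOp_mk μ _ s t _ ?_ fun U hU => joins_star _ _ _ _ ?_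
  · exact shape_attachWith _ _
      (map_dotL (fun a b => μ (a ⊗ₜ b)) (fun _ => ()) (fun _ _ => ()) (fun _ _ => rfl) s.1 t.1)
  · rw [star_eq _ s.2.2 t.2.2]
    have : U.1 ∈ dotL (fun a b => μ (a ⊗ₜ b)) s.1 t.1 := (List.mem_attachWith _ U).1 hU
    simp [this]

end LushSpace

end BraidedTridend

namespace BraidedTridend

/-! ### Crossings

A crossing of `X` and `W` is a linear map `X ⊗ W → W ⊗ X`. -/

section Crossings

variable {k : Type*} [CommRing k]
  {U V W X B C D : Type*}
  [AddCommGroup U] [Module k U] [AddCommGroup V] [Module k V] [AddCommGroup W] [Module k W]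
  [AddCommGroup X] [Module k X] [AddCommGroup B] [Module k B] [AddCommGroup C] [Module k C]
  [AddCommGroup D] [Module k D]
  {U' V' W' X' B' C' : Type*}
  [AddCommGroup U'] [Module k U'] [AddCommGroup V'] [Module k V'] [AddCommGroup W'] [Module k W']
  [AddCommGroup X'] [Module k X'] [AddCommGroup B'] [Module k B'] [AddCommGroup C'] [Module k C']
  {Y Z : Type*} [AddCommGroup Y] [Module k Y] [AddCommGroup Z] [Module k Z]

-- On summands, each product is a finite sum of maps `incl U ∘ join`, where `join` concatenates the
-- decorations or multiplies the two adjacent ones and depends only on the degrees, and the braiding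
-- is `beta` carried along the inclusions. This separates the braiding from the combinatorics of
-- trees.
--
-- Braiding. The crossings `beta` of tensor powers satisfy both hexagon identities (`beta_add_left`,
-- `beta_add_right`) for any linear `σ`. By the hexagons, a map of tensor powers that commutes with
-- the crossings with one factor `A` commutes with those with every power (`isNatural_of_one`), and
-- such natural maps are closed under composition and juxtaposition. The braid relation says that
-- `σ` is natural, and compatibility says that the product of `A` is. Hence the words `betaWord` and
-- the maps `join` are natural. The first gives the braid relation on the space of trees
-- (`IsBraiding.braiding`). The second gives the compatibility of any product of the form `treeOp`,
-- whatever trees it sums over (`IsBraidedOp.treeOp`).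
--
-- Tridendriform identities. They are proved for formal sums of decorated trees. Four of them need
-- only an exchange of independent graftings or the associativity of the product of `A`. The other
-- three follow from associativity of `star` on smaller triples, and the seven together give
-- associativity of `star`; hence the induction in `starAssoc`. Decorated lush trees span, so the
-- identities pass to the whole space.
--
-- Universal property. In any tridendriform algebra a decorated tree has the value `T₀ ≻ ((x₁ ≺ T₁)
-- · ((x₂ ≺ T₂) · ⋯ (x_k ≺ T_k)))`. A lush tree equals its own value in the space of trees
-- (`eval_emb`), and homomorphisms commute with evaluation, so an extension of `ψ` is unique.
-- Conversely, evaluation is multiplicative (`evalMul`), which makes it a tridendriform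
-- homomorphism. On each shape it is an iterated product of copies of `ψ`
-- (`exists_isGenerated_eval`), so the hexagons and the compatibility of the products of `R` with
-- `τ` show that it respects the braidings (`IsGenerated.intertwines`).

/-- The maps `f` and `q` commute with the two crossings. -/
def Intertwines (β : X ⊗[k] W →ₗ[k] W ⊗[k] X) (β' : X' ⊗[k] W' →ₗ[k] W' ⊗[k] X')
    (f : X →ₗ[k] X') (q : W →ₗ[k] W') : Prop :=
  TensorProduct.map q f ∘ₗ β = β' ∘ₗ TensorProduct.map f q

theorem Intertwines.apply {β : X ⊗[k] W →ₗ[k] W ⊗[k] X} {β' : X' ⊗[k] W' →ₗ[k] W' ⊗[k] X'}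
    {f : X →ₗ[k] X'} {q : W →ₗ[k] W'} (h : Intertwines β β' f q) (x : X) (y : W) :
    TensorProduct.map q f (β (x ⊗ₜ y)) = β' (f x ⊗ₜ q y) := by
  simpa using LinearMap.congr_fun h (x ⊗ₜ y)

theorem intertwines_of_apply {β : X ⊗[k] W →ₗ[k] W ⊗[k] X}
    {β' : X' ⊗[k] W' →ₗ[k] W' ⊗[k] X'} {f : X →ₗ[k] X'} {q : W →ₗ[k] W'}
    (h : ∀ x y, TensorProduct.map q f (β (x ⊗ₜ y)) = β' (f x ⊗ₜ q y)) : Intertwines β β' f q :=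
  TensorProduct.ext' fun x y => by simpa using h x y

theorem Intertwines.id (β : X ⊗[k] W →ₗ[k] W ⊗[k] X) :
    Intertwines β β LinearMap.id LinearMap.id := by
  simp [Intertwines]

theorem Intertwines.zero_left (β : X ⊗[k] W →ₗ[k] W ⊗[k] X)
    (β' : X' ⊗[k] W' →ₗ[k] W' ⊗[k] X') (q : W →ₗ[k] W') : Intertwines β β' 0 q :=
  intertwines_of_apply fun x y => by simp

theorem Intertwines.zero_right (β : X ⊗[k] W →ₗ[k] W ⊗[k] X)
    (β' : X' ⊗[k] W' →ₗ[k] W' ⊗[k] X') (f : X →ₗ[k] X') : Intertwines β β' f 0 :=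
  intertwines_of_apply fun x y => by simp

theorem Intertwines.comp {β : X ⊗[k] W →ₗ[k] W ⊗[k] X} {β' : X' ⊗[k] W' →ₗ[k] W' ⊗[k] X'}
    {β'' : Z ⊗[k] Y →ₗ[k] Y ⊗[k] Z} {f : X →ₗ[k] X'} {q : W →ₗ[k] W'}
    {f' : X' →ₗ[k] Z} {q' : W' →ₗ[k] Y} (h' : Intertwines β' β'' f' q')
    (h : Intertwines β β' f q) : Intertwines β β'' (f' ∘ₗ f) (q' ∘ₗ q) := by
  rw [Intertwines] at *
  rw [TensorProduct.map_comp, TensorProduct.map_comp, LinearMap.comp_assoc, h,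
    ← LinearMap.comp_assoc, h', LinearMap.comp_assoc]

/-- Surjectivity lets `β'` be tested on images only. In this way identities pass from `A^{⊗m} ⊗
A^{⊗n}` to `A^{⊗(m+n)}`. -/
theorem Intertwines.cancel {β : X ⊗[k] W →ₗ[k] W ⊗[k] X} {β' : X' ⊗[k] W' →ₗ[k] W' ⊗[k] X'}
    {β'' : Z ⊗[k] Y →ₗ[k] Y ⊗[k] Z} {f : X →ₗ[k] X'} {q : W →ₗ[k] W'}
    {f' : X' →ₗ[k] Z} {q' : W' →ₗ[k] Y} (h : Intertwines β β' f q)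
    (h' : Intertwines β β'' (f' ∘ₗ f) (q' ∘ₗ q)) (hf : Function.Surjective f)
    (hq : Function.Surjective q) : Intertwines β' β'' f' q' := by
  refine intertwines_of_apply fun x y => ?_
  obtain ⟨x, rfl⟩ := hf x
  obtain ⟨y, rfl⟩ := hq y
  have := h'.apply x y
  rwa [TensorProduct.map_comp, LinearMap.comp_apply, h.apply] at this

theorem Intertwines.symm {β : X ⊗[k] W →ₗ[k] W ⊗[k] X} {β' : X' ⊗[k] W' →ₗ[k] W' ⊗[k] X'}
    {f : X ≃ₗ[k] X'} {q : W ≃ₗ[k] W'} (h : Intertwines β β' f.toLinearMap q.toLinearMap) :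
    Intertwines β' β f.symm.toLinearMap q.symm.toLinearMap :=
  h.cancel (by simpa using Intertwines.id β) f.surjective q.surjective

-- Crossings of tensor products

/-- The crossing of `U ⊗ V` and `W` made of crossings of `U` and `W` and of `V` and `W`. -/
noncomputable def crossL (βU : U ⊗[k] W →ₗ[k] W ⊗[k] U) (βV : V ⊗[k] W →ₗ[k] W ⊗[k] V) :
    (U ⊗[k] V) ⊗[k] W →ₗ[k] W ⊗[k] (U ⊗[k] V) :=
  (TensorProduct.assoc k W U V).toLinearMap ∘ₗ βU.rTensor V ∘ₗ
    (TensorProduct.assoc k U W V).symm.toLinearMap ∘ₗ βV.lTensor U ∘ₗ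
      (TensorProduct.assoc k U V W).toLinearMap

/-- The crossing of `U` and `B ⊗ C` made of crossings of `U` and `B` and of `U` and `C`. -/
noncomputable def crossR (βB : U ⊗[k] B →ₗ[k] B ⊗[k] U) (βC : U ⊗[k] C →ₗ[k] C ⊗[k] U) :
    U ⊗[k] (B ⊗[k] C) →ₗ[k] (B ⊗[k] C) ⊗[k] U :=
  (TensorProduct.assoc k B C U).symm.toLinearMap ∘ₗ βC.lTensor B ∘ₗ
    (TensorProduct.assoc k B U C).toLinearMap ∘ₗ βB.rTensor C ∘ₗ
      (TensorProduct.assoc k U B C).symm.toLinearMap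

theorem crossL_tmul (βU : U ⊗[k] W →ₗ[k] W ⊗[k] U) (βV : V ⊗[k] W →ₗ[k] W ⊗[k] V)
    (x : U) (y : V) (z : W) :
    crossL βU βV ((x ⊗ₜ y) ⊗ₜ z) = TensorProduct.assoc k W U V (βU.rTensor V
      ((TensorProduct.assoc k U W V).symm (x ⊗ₜ βV (y ⊗ₜ z)))) := by
  simp [crossL]

theorem crossR_tmul (βB : U ⊗[k] B →ₗ[k] B ⊗[k] U) (βC : U ⊗[k] C →ₗ[k] C ⊗[k] U)
    (x : U) (y : B) (z : C) :
    crossR βB βC (x ⊗ₜ (y ⊗ₜ z)) = (TensorProduct.assoc k B C U).symm (βC.lTensor B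
      (TensorProduct.assoc k B U C (βB (x ⊗ₜ y) ⊗ₜ z))) := by
  simp [crossR]

theorem Intertwines.crossL {βU : U ⊗[k] W →ₗ[k] W ⊗[k] U} {βV : V ⊗[k] W →ₗ[k] W ⊗[k] V}
    {βU' : U' ⊗[k] W' →ₗ[k] W' ⊗[k] U'} {βV' : V' ⊗[k] W' →ₗ[k] W' ⊗[k] V'}
    {f : U →ₗ[k] U'} {g : V →ₗ[k] V'} {q : W →ₗ[k] W'} (hU : Intertwines βU βU' f q)
    (hV : Intertwines βV βV' g q) :
    Intertwines (crossL βU βV) (crossL βU' βV') (TensorProduct.map f g) q := by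
  refine intertwines_of_apply fun x z => ?_
  induction x with
  | zero => simp
  | add x y hx hy => simp only [TensorProduct.add_tmul, map_add, hx, hy]
  | tmul x y =>
    rw [crossL_tmul, TensorProduct.map_tmul, crossL_tmul, ← hV.apply]
    generalize βV (y ⊗ₜ z) = t
    induction t with
    | zero => simp
    | add s t hs ht => simp only [TensorProduct.tmul_add, map_add, hs, ht]
    | tmul z y =>
      simp only [TensorProduct.assoc_symm_tmul, LinearMap.rTensor_tmul, TensorProduct.map_tmul]
      rw [← hU.apply]
      generalize βU (x ⊗ₜ z) = t
      induction t with
      | zero => simp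
      | add s t hs ht => simp only [TensorProduct.add_tmul, map_add, hs, ht]
      | tmul z x => simp

theorem Intertwines.crossR {βB : U ⊗[k] B →ₗ[k] B ⊗[k] U} {βC : U ⊗[k] C →ₗ[k] C ⊗[k] U}
    {βB' : U' ⊗[k] B' →ₗ[k] B' ⊗[k] U'} {βC' : U' ⊗[k] C' →ₗ[k] C' ⊗[k] U'}
    {f : U →ₗ[k] U'} {g : B →ₗ[k] B'} {h : C →ₗ[k] C'} (hB : Intertwines βB βB' f g)
    (hC : Intertwines βC βC' f h) :
    Intertwines (crossR βB βC) (crossR βB' βC') f (TensorProduct.map g h) := by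
  refine intertwines_of_apply fun x z => ?_
  induction z with
  | zero => simp
  | add y z hy hz => simp only [TensorProduct.tmul_add, map_add, hy, hz]
  | tmul y z =>
    rw [crossR_tmul, TensorProduct.map_tmul, crossR_tmul, ← hB.apply]
    generalize βB (x ⊗ₜ y) = t
    induction t with
    | zero => simp
    | add s t hs ht => simp only [TensorProduct.add_tmul, map_add, hs, ht]
    | tmul y x =>
      simp only [TensorProduct.assoc_tmul, LinearMap.lTensor_tmul, TensorProduct.map_tmul]
      rw [← hC.apply]
      generalize βC (x ⊗ₜ z) = t
      induction t with
      | zero => simp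
      | add s t hs ht => simp only [TensorProduct.tmul_add, map_add, hs, ht]
      | tmul z x => simp

/-- Both sides perform the same four elementary crossings. They differ only in the order of the
crossings of `U` with `B` and of `V` with `C`, which act on disjoint factors; no braid relation
enters. -/
theorem crossR_crossL (βUB : U ⊗[k] B →ₗ[k] B ⊗[k] U) (βVB : V ⊗[k] B →ₗ[k] B ⊗[k] V)
    (βUC : U ⊗[k] C →ₗ[k] C ⊗[k] U) (βVC : V ⊗[k] C →ₗ[k] C ⊗[k] V) :
    crossR (crossL βUB βVB) (crossL βUC βVC) = crossL (crossR βUB βUC) (crossR βVB βVC) := by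
  refine TensorProduct.ext_fourfold' fun x y b c => ?_
  rw [crossR_tmul, crossL_tmul, crossL_tmul, crossR_tmul]
  generalize βVB (y ⊗ₜ b) = t
  induction t with
  | zero => simp
  | add s t hs ht =>
    simp only [TensorProduct.tmul_add, TensorProduct.add_tmul, map_add, hs, ht]
  | tmul b y =>
    simp only [TensorProduct.assoc_symm_tmul, TensorProduct.assoc_tmul, LinearMap.rTensor_tmul,
      LinearMap.lTensor_tmul]
    -- Common normal form of the two sides: the crossings of `U, B` and `V, C` side by side, then
    -- the crossing of `U, C` in the middle. `h` reaches it from the left side and `h'` from the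
    -- right side.
    have h : ∀ t : B ⊗[k] U, (TensorProduct.assoc k B C (U ⊗[k] V)).symm
        ((crossL βUC βVC).lTensor B (TensorProduct.assoc k B (U ⊗[k] V) C
          (TensorProduct.assoc k B U V (t ⊗ₜ y) ⊗ₜ c))) =
        (TensorProduct.tensorTensorTensorAssoc k B C U V).symm ((βUC.lTensor B).rTensor V
          (TensorProduct.tensorTensorTensorAssoc k B U C V (t ⊗ₜ βVC (y ⊗ₜ c)))) := fun t => by
      induction t with
      | zero => simp
      | add s t hs ht => simp only [TensorProduct.add_tmul, map_add, hs, ht]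
      | tmul b x =>
        simp only [TensorProduct.assoc_tmul, LinearMap.lTensor_tmul, crossL_tmul]
        generalize βVC (y ⊗ₜ c) = t
        induction t with
        | zero => simp
        | add s t hs ht => simp only [TensorProduct.tmul_add, map_add, hs, ht]
        | tmul c y =>
          simp only [TensorProduct.assoc_symm_tmul, LinearMap.rTensor_tmul,
            TensorProduct.tensorTensorTensorAssoc_tmul, LinearMap.lTensor_tmul]
          generalize βUC (x ⊗ₜ c) = t
          induction t with
          | zero => simp
          | add s t hs ht =>
            simp only [TensorProduct.tmul_add, TensorProduct.add_tmul, map_add, hs, ht]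
          | tmul c x => simp
    have h' : ∀ t : C ⊗[k] V, TensorProduct.assoc k (B ⊗[k] C) U V
        ((crossR βUB βUC).rTensor V ((TensorProduct.assoc k U (B ⊗[k] C) V).symm
          (x ⊗ₜ (TensorProduct.assoc k B C V).symm (b ⊗ₜ t)))) =
        (TensorProduct.tensorTensorTensorAssoc k B C U V).symm ((βUC.lTensor B).rTensor V
          (TensorProduct.tensorTensorTensorAssoc k B U C V (βUB (x ⊗ₜ b) ⊗ₜ t))) := fun t => by
      induction t with
      | zero => simp
      | add s t hs ht => simp only [TensorProduct.tmul_add, map_add, hs, ht]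
      | tmul c y =>
        simp only [TensorProduct.assoc_symm_tmul, LinearMap.rTensor_tmul, crossR_tmul]
        generalize βUB (x ⊗ₜ b) = t
        induction t with
        | zero => simp
        | add s t hs ht => simp only [TensorProduct.add_tmul, map_add, hs, ht]
        | tmul b x =>
          simp only [TensorProduct.assoc_tmul, LinearMap.lTensor_tmul,
            TensorProduct.tensorTensorTensorAssoc_tmul, LinearMap.rTensor_tmul]
          generalize βUC (x ⊗ₜ c) = t
          induction t with
          | zero => simp
          | add s t hs ht =>
            simp only [TensorProduct.tmul_add, TensorProduct.add_tmul, map_add, hs, ht]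
          | tmul c x => simp
    exact (h _).trans (h' _).symm

/-- A hexagon identity passes from `U` and `V` to a quotient `X` of `U ⊗ V`. -/
theorem intertwines_right_of_surjective {m : U ⊗[k] V →ₗ[k] X} (hm : Function.Surjective m)
    {n : B ⊗[k] C →ₗ[k] D}
    {βUB : U ⊗[k] B →ₗ[k] B ⊗[k] U} {βVB : V ⊗[k] B →ₗ[k] B ⊗[k] V}
    {βUC : U ⊗[k] C →ₗ[k] C ⊗[k] U} {βVC : V ⊗[k] C →ₗ[k] C ⊗[k] V}
    {βUD : U ⊗[k] D →ₗ[k] D ⊗[k] U} {βVD : V ⊗[k] D →ₗ[k] D ⊗[k] V}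
    {βXB : X ⊗[k] B →ₗ[k] B ⊗[k] X} {βXC : X ⊗[k] C →ₗ[k] C ⊗[k] X}
    {βXD : X ⊗[k] D →ₗ[k] D ⊗[k] X}
    (hB : Intertwines (crossL βUB βVB) βXB m LinearMap.id)
    (hC : Intertwines (crossL βUC βVC) βXC m LinearMap.id)
    (hD : Intertwines (crossL βUD βVD) βXD m LinearMap.id)
    (hU : Intertwines (crossR βUB βUC) βUD LinearMap.id n)
    (hV : Intertwines (crossR βVB βVC) βVD LinearMap.id n) :
    Intertwines (crossR βXB βXC) βXD LinearMap.id n := by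
  have h₁ := hB.crossR hC
  have h₂ := hD.comp (hU.crossL hV)
  rw [TensorProduct.map_id, crossR_crossL] at h₁
  rw [TensorProduct.map_id] at h₂
  exact h₁.cancel h₂ hm Function.surjective_id

/-- If `m` and `m'` are products of crossings, and `f` and `g` commute with crossings, then so
does `h` with `h m = m' (f ⊗ g)`. -/
theorem Intertwines.left_of_surjective {m : U ⊗[k] V →ₗ[k] X} {m' : U' ⊗[k] V' →ₗ[k] X'}
    {f : U →ₗ[k] U'} {g : V →ₗ[k] V'} {h : X →ₗ[k] X'} {q : W →ₗ[k] W'}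
    {βU : U ⊗[k] W →ₗ[k] W ⊗[k] U} {βV : V ⊗[k] W →ₗ[k] W ⊗[k] V}
    {βU' : U' ⊗[k] W' →ₗ[k] W' ⊗[k] U'} {βV' : V' ⊗[k] W' →ₗ[k] W' ⊗[k] V'}
    {β : X ⊗[k] W →ₗ[k] W ⊗[k] X} {β' : X' ⊗[k] W' →ₗ[k] W' ⊗[k] X'}
    (hU : Intertwines βU βU' f q) (hV : Intertwines βV βV' g q)
    (hm : Intertwines (BraidedTridend.crossL βU βV) β m LinearMap.id)
    (hm' : Intertwines (BraidedTridend.crossL βU' βV') β' m' LinearMap.id)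
    (hh : h ∘ₗ m = m' ∘ₗ TensorProduct.map f g) (hs : Function.Surjective m) :
    Intertwines β β' h q := by
  have := hm'.comp (hU.crossL hV)
  rw [← hh] at this
  exact hm.cancel this hs Function.surjective_id

theorem Intertwines.right_of_surjective {m : B ⊗[k] C →ₗ[k] W} {m' : B' ⊗[k] C' →ₗ[k] W'}
    {f : B →ₗ[k] B'} {g : C →ₗ[k] C'} {h : W →ₗ[k] W'} {q : U →ₗ[k] U'}
    {βB : U ⊗[k] B →ₗ[k] B ⊗[k] U} {βC : U ⊗[k] C →ₗ[k] C ⊗[k] U}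
    {βB' : U' ⊗[k] B' →ₗ[k] B' ⊗[k] U'} {βC' : U' ⊗[k] C' →ₗ[k] C' ⊗[k] U'}
    {β : U ⊗[k] W →ₗ[k] W ⊗[k] U} {β' : U' ⊗[k] W' →ₗ[k] W' ⊗[k] U'}
    (hB : Intertwines βB βB' q f) (hC : Intertwines βC βC' q g)
    (hm : Intertwines (BraidedTridend.crossR βB βC) β LinearMap.id m)
    (hm' : Intertwines (BraidedTridend.crossR βB' βC') β' LinearMap.id m')
    (hh : h ∘ₗ m = m' ∘ₗ TensorProduct.map f g) (hs : Function.Surjective m) :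
    Intertwines β β' q h := by
  have := hm'.comp (hB.crossR hC)
  rw [← hh] at this
  exact hm.cancel this Function.surjective_id hs

/-- Compatibility is naturality of the crossing `σ` under `p` in each of its two arguments. Up to
rebracketing the equations coincide, with the two conjuncts in the opposite order. -/
theorem isBraidedOp_iff {p : V ⊗[k] V →ₗ[k] V} {σ : V ⊗[k] V →ₗ[k] V ⊗[k] V} :
    IsBraidedOp p σ ↔ Intertwines (crossL σ σ) σ p LinearMap.id ∧
      Intertwines (crossR σ σ) σ LinearMap.id p := by
  have h₁ : ∀ x y z : V, σ (x ⊗ₜ p (y ⊗ₜ z)) = (p.rTensor V ∘ₗ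
      (TensorProduct.assoc k V V V).symm.toLinearMap) (sigmaTwo σ (sigmaOne σ (x ⊗ₜ (y ⊗ₜ z)))) ↔
      TensorProduct.map p LinearMap.id (crossR σ σ (x ⊗ₜ (y ⊗ₜ z))) =
        σ (x ⊗ₜ p (y ⊗ₜ z)) := fun x y z => by
    rw [eq_comm]
    rfl
  have h₂ : ∀ x y z : V, σ (p (x ⊗ₜ y) ⊗ₜ z) =
      p.lTensor V (sigmaOne σ (sigmaTwo σ (x ⊗ₜ (y ⊗ₜ z)))) ↔
      TensorProduct.map LinearMap.id p (crossL σ σ ((x ⊗ₜ y) ⊗ₜ z)) =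
        σ (p (x ⊗ₜ y) ⊗ₜ z) := fun x y z => by
    rw [eq_comm]
    rfl
  refine and_comm.trans (and_congr ⟨fun h => ?_, fun h => ?_⟩ ⟨fun h => ?_, fun h => ?_⟩)
  · rw [Intertwines]
    refine TensorProduct.ext_threefold fun x y z => ?_
    exact (h₂ x y z).1 (LinearMap.congr_fun h (x ⊗ₜ (y ⊗ₜ z)))
  · refine TensorProduct.ext_threefold' fun x y z => ?_
    exact (h₂ x y z).2 (LinearMap.congr_fun h ((x ⊗ₜ y) ⊗ₜ z))
  · refine TensorProduct.ext_threefold' fun x y z => ?_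
    exact (h₁ x y z).1 (LinearMap.congr_fun h (x ⊗ₜ (y ⊗ₜ z)))
  · refine TensorProduct.ext_threefold' fun x y z => ?_
    exact (h₁ x y z).2 (LinearMap.congr_fun h (x ⊗ₜ (y ⊗ₜ z)))

theorem IsBraiding.intertwines_left {σ : V ⊗[k] V →ₗ[k] V ⊗[k] V} (h : IsBraiding σ) :
    Intertwines (crossL σ σ) (crossL σ σ) σ LinearMap.id := by
  refine TensorProduct.ext_threefold fun x y z => ?_
  exact (LinearMap.congr_fun h (x ⊗ₜ (y ⊗ₜ z))).symm

/-- The braid relation says that `σ` itself commutes with the crossing of `V` and `V ⊗ V`. It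
thereby takes the same form as compatibility of a product, and one notion of naturality serves both.
-/
theorem isBraiding_iff {σ : V ⊗[k] V →ₗ[k] V ⊗[k] V} :
    IsBraiding σ ↔ Intertwines (crossR σ σ) (crossR σ σ) LinearMap.id σ := by
  have key : ∀ x y z : V, (sigmaOne σ ∘ₗ sigmaTwo σ ∘ₗ sigmaOne σ) (x ⊗ₜ (y ⊗ₜ z)) =
      (sigmaTwo σ ∘ₗ sigmaOne σ ∘ₗ sigmaTwo σ) (x ⊗ₜ (y ⊗ₜ z)) ↔
      (TensorProduct.map σ LinearMap.id ∘ₗ crossR σ σ) (x ⊗ₜ (y ⊗ₜ z)) =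
        (crossR σ σ ∘ₗ TensorProduct.map LinearMap.id σ) (x ⊗ₜ (y ⊗ₜ z)) := fun x y z => by
    rw [← (TensorProduct.assoc k V V V).symm.injective.eq_iff]
    refine Eq.congr ?_ rfl
    exact LinearEquiv.symm_apply_apply _ _
  refine ⟨fun h => ?_, fun h => ?_⟩
  · exact TensorProduct.ext_threefold' fun x y z => (key x y z).1 (LinearMap.congr_fun h _)
  · exact TensorProduct.ext_threefold' fun x y z => (key x y z).2 (LinearMap.congr_fun h _)

end Crossings

section TensorPowerCrossings

variable {k : Type u} [CommRing k] {A : Type v} [AddCommGroup A] [Module k A]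

/-! ### Tensor powers inside the tensor algebra -/

/-- The inclusion of `A^{⊗n}` in the tensor algebra. -/
noncomputable def powIncl (n : ℕ) : ⨂[k]^n A →ₗ[k] DirectSum ℕ fun n => ⨂[k]^n A :=
  DirectSum.lof k ℕ (fun n => ⨂[k]^n A) n

theorem powIncl_injective (n : ℕ) : Function.Injective (powIncl (k := k) (A := A) n) :=
  DirectSum.of_injective n

theorem powIncl_mulEquiv {m n : ℕ} (x : ⨂[k]^m A) (y : ⨂[k]^n A) :
    powIncl (m + n) (TensorPower.mulEquiv (x ⊗ₜ y)) = powIncl m x * powIncl n y :=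
  (DirectSum.of_mul_of (A := fun n => ⨂[k]^n A) x y).symm

/-- In the tensor algebra casts disappear and concatenation is an associative product, so elements
of powers with different expressions for the exponent can be compared there. -/
theorem powIncl_cast {m n : ℕ} (h : m = n) (x : ⨂[k]^m A) :
    powIncl n (TensorPower.cast k A h x) = powIncl m x := by
  subst h
  simp

/-- A generator of `A^{⊗0}`. -/
noncomputable def powOne : ⨂[k]^0 A := TensorPower.algebraMap₀ (1 : k)

theorem powIncl_powOne : powIncl 0 (powOne (k := k) (A := A)) = 1 := by
  rw [powOne, TensorPower.algebraMap₀_one]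
  rfl

theorem exists_smul_powOne (x : ⨂[k]^0 A) : ∃ c : k, x = c • powOne := by
  obtain ⟨c, rfl⟩ := (TensorPower.algebraMap₀ (R := k) (M := A)).surjective x
  exact ⟨c, by rw [powOne, ← map_smul, smul_eq_mul, mul_one]⟩

/-- The power is spanned by the elements `p ⊗ c ⊗ q`. The hypothesis `mul` identifies such an
element by its image in the tensor algebra, so that no cast occurs in it. -/
theorem pow_induction {N i r : ℕ} (h : i + 2 + r = N) {motive : ⨂[k]^N A → Prop} (x : ⨂[k]^N A)
    (zero : motive 0) (add : ∀ x y, motive x → motive y → motive (x + y))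
    (mul : ∀ (p : ⨂[k]^i A) (c : A ⊗[k] A) (q : ⨂[k]^r A) (x : ⨂[k]^N A),
      powIncl N x = powIncl i p * powIncl 2 (twoEquiv c) * powIncl r q → motive x) : motive x := by
  subst h
  obtain ⟨z, rfl⟩ := TensorPower.mulEquiv.surjective x
  induction z with
  | zero => simpa using zero
  | add x y hx hy => rw [map_add]; exact add _ _ hx hy
  | tmul x q =>
    obtain ⟨z, rfl⟩ := TensorPower.mulEquiv.surjective x
    induction z with
    | zero => simpa using zero
    | add x y hx hy => rw [map_add, TensorProduct.add_tmul, map_add]; exact add _ _ hx hy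
    | tmul p c =>
      obtain ⟨c, rfl⟩ := twoEquiv.surjective c
      exact mul p c q _ (by rw [powIncl_mulEquiv, powIncl_mulEquiv])

/-! ### Operators acting on the last or on the first factors -/

variable (σ : A ⊗[k] A →ₗ[k] A ⊗[k] A)

theorem powIncl_sigmaAt {N i r : ℕ} (hN : i + 2 + r = N) {p : ⨂[k]^i A} {c : A ⊗[k] A}
    {q : ⨂[k]^r A} {x : ⨂[k]^N A}
    (hx : powIncl N x = powIncl i p * powIncl 2 (twoEquiv c) * powIncl r q) :
    powIncl N (sigmaAt σ N i x) = powIncl i p * powIncl 2 (twoEquiv (σ c)) * powIncl r q := by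
  -- The number of factors to the right is now literally the truncated difference in `sigmaAt`,
  -- whose first branch therefore applies.
  obtain rfl : r = N - i - 2 := by omega
  have : x = TensorPower.cast k A hN
      (TensorPower.mulEquiv (TensorPower.mulEquiv (p ⊗ₜ twoEquiv c) ⊗ₜ q)) := by
    apply powIncl_injective
    rw [powIncl_cast, powIncl_mulEquiv, powIncl_mulEquiv, hx]
  subst this
  rw [sigmaAt, dif_pos hN, ← powIncl_mulEquiv, ← powIncl_mulEquiv]
  simp only [LinearMap.comp_apply, LinearEquiv.coe_coe, powIncl_cast]
  simp [opAt]

/-- `f` acts on the last `b` of `a + b` factors as `g`. -/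
def ActsOnLast {N b : ℕ} (a : ℕ) (f : Module.End k (⨂[k]^N A)) (g : Module.End k (⨂[k]^b A)) :
    Prop :=
  ∀ w (x : ⨂[k]^a A) y, powIncl N w = powIncl a x * powIncl b y →
    powIncl N (f w) = powIncl a x * powIncl b (g y)

/-- `f` acts on the first `a` of `a + b` factors as `g`. -/
def ActsOnFirst {N a : ℕ} (b : ℕ) (f : Module.End k (⨂[k]^N A)) (g : Module.End k (⨂[k]^a A)) :
    Prop :=
  ∀ w x (y : ⨂[k]^b A), powIncl N w = powIncl a x * powIncl b y →
    powIncl N (f w) = powIncl a (g x) * powIncl b y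

theorem ActsOnLast.list_prod {N a b : ℕ} (l : List ℕ) {f : ℕ → Module.End k (⨂[k]^N A)}
    {g : ℕ → Module.End k (⨂[k]^b A)} (h : ∀ j ∈ l, ActsOnLast a (f j) (g j)) :
    ActsOnLast a (l.map f).prod (l.map g).prod := by
  induction l with
  | nil => exact fun w x y hw => by simpa using hw
  | cons j l ih =>
    intro w x y hw
    simp only [List.map_cons, List.prod_cons, Module.End.mul_apply]
    exact h j (by simp) _ _ _ (ih (fun i hi => h i (by simp [hi])) _ _ _ hw)

theorem ActsOnFirst.list_prod {N a b : ℕ} (l : List ℕ) {f : ℕ → Module.End k (⨂[k]^N A)}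
    {g : ℕ → Module.End k (⨂[k]^a A)} (h : ∀ j ∈ l, ActsOnFirst b (f j) (g j)) :
    ActsOnFirst b (l.map f).prod (l.map g).prod := by
  induction l with
  | nil => exact fun w x y hw => by simpa using hw
  | cons j l ih =>
    intro w x y hw
    simp only [List.map_cons, List.prod_cons, Module.End.mul_apply]
    exact h j (by simp) _ _ _ (ih (fun i hi => h i (by simp [hi])) _ _ _ hw)

theorem eq_cast_mulEquiv {N a b : ℕ} (h : a + b = N) {w : ⨂[k]^N A} {x : ⨂[k]^a A} {y : ⨂[k]^b A}
    (hw : powIncl N w = powIncl a x * powIncl b y) :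
    w = TensorPower.cast k A h (TensorPower.mulEquiv (x ⊗ₜ y)) := by
  apply powIncl_injective
  rw [hw, powIncl_cast, powIncl_mulEquiv]

theorem actsOnLast_sigmaAt {N a b : ℕ} (h : a + b = N) {i : ℕ} (hi : i + 2 ≤ b) :
    ActsOnLast a (sigmaAt σ N (a + i)) (sigmaAt σ b i) := by
  intro w x y hw
  obtain rfl := eq_cast_mulEquiv h hw
  clear hw
  obtain ⟨r, rfl⟩ := Nat.exists_eq_add_of_le hi
  induction y using pow_induction rfl with
  | zero => simp
  | add y z hy hz => simp only [TensorProduct.tmul_add, map_add, hy, hz, mul_add]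
  | mul p c q y hy =>
    rw [powIncl_sigmaAt σ rfl hy, powIncl_sigmaAt σ (p := TensorPower.mulEquiv (x ⊗ₜ p))
      (c := c) (q := q) (by omega)]
    · simp only [powIncl_mulEquiv, mul_assoc]
    · rw [powIncl_cast, powIncl_mulEquiv, hy]
      simp only [powIncl_mulEquiv, mul_assoc]

theorem actsOnFirst_sigmaAt {N a b : ℕ} (h : a + b = N) {i : ℕ} (hi : i + 2 ≤ a) :
    ActsOnFirst b (sigmaAt σ N i) (sigmaAt σ a i) := by
  intro w x y hw
  obtain rfl := eq_cast_mulEquiv h hw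
  clear hw
  obtain ⟨r, rfl⟩ := Nat.exists_eq_add_of_le hi
  induction x using pow_induction rfl with
  | zero => simp
  | add y z hy hz => simp only [TensorProduct.add_tmul, map_add, hy, hz, add_mul]
  | mul p c q x hx =>
    rw [powIncl_sigmaAt σ rfl hx, powIncl_sigmaAt σ (p := p)
      (c := c) (q := TensorPower.mulEquiv (q ⊗ₜ y)) (by omega)]
    · simp only [powIncl_mulEquiv, mul_assoc]
    · rw [powIncl_cast, powIncl_mulEquiv, hx]
      simp only [powIncl_mulEquiv, mul_assoc]

theorem actsOnLast_sigmaRow {N a b : ℕ} (h : a + b = N) {n i : ℕ} (hi : i + n + 1 ≤ b) :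
    ActsOnLast a (sigmaRow σ N n (a + i)) (sigmaRow σ b n i) := by
  refine ActsOnLast.list_prod _ fun j hj => ?_
  rw [List.mem_reverse, List.mem_range] at hj
  rw [Nat.add_assoc a]
  exact actsOnLast_sigmaAt σ h (by omega)

theorem actsOnFirst_sigmaRow {N a b : ℕ} (h : a + b = N) {n i : ℕ} (hi : i + n + 1 ≤ a) :
    ActsOnFirst b (sigmaRow σ N n i) (sigmaRow σ a n i) := by
  refine ActsOnFirst.list_prod _ fun j hj => ?_
  rw [List.mem_reverse, List.mem_range] at hj
  exact actsOnFirst_sigmaAt σ h (by omega)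

/-- A factor passes `m + n` others by passing the first `m` and then, from position `m + i`, the
remaining `n`; the later move is the left factor of the product. -/
theorem sigmaRow_add (N m n i : ℕ) :
    sigmaRow σ N (m + n) i = sigmaRow σ N n (m + i) * sigmaRow σ N m i := by
  simp only [sigmaRow, List.range_add, List.reverse_append, List.map_append, List.prod_append,
    List.map_reverse, List.map_map]
  congr 4
  funext j
  simp only [Function.comp_apply]
  congr 1
  omega

theorem betaWord_one (n : ℕ) : betaWord σ 1 n = sigmaRow σ (1 + n) n 0 := by
  simp [betaWord]

theorem powIncl_beta {m n : ℕ} (x : ⨂[k]^m A) (y : ⨂[k]^n A) :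
    powIncl (n + m) (TensorPower.mulEquiv (beta σ m n (x ⊗ₜ y))) =
      powIncl (m + n) (betaWord σ m n (TensorPower.mulEquiv (x ⊗ₜ y))) := by
  simp [beta, powIncl_cast]

/-! ### The hexagon identities -/

theorem beta_zero_left {n : ℕ} (y : ⨂[k]^n A) : beta σ 0 n (powOne ⊗ₜ y) = y ⊗ₜ powOne := by
  apply TensorPower.mulEquiv.injective
  apply powIncl_injective
  rw [powIncl_beta, powIncl_mulEquiv]
  simp [betaWord, powIncl_mulEquiv, powIncl_powOne]

theorem beta_zero_right {n : ℕ} (x : ⨂[k]^n A) : beta σ n 0 (x ⊗ₜ powOne) = powOne ⊗ₜ x := by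
  apply TensorPower.mulEquiv.injective
  apply powIncl_injective
  rw [powIncl_beta, powIncl_mulEquiv]
  have := powIncl_mulEquiv x (powOne (k := k))
  simpa [betaWord, sigmaRow, powIncl_powOne] using this

theorem beta_one_one (x y : A) : beta σ 1 1 (oneEquiv x ⊗ₜ oneEquiv y) =
    TensorProduct.congr oneEquiv oneEquiv (σ (x ⊗ₜ y)) := by
  apply TensorPower.mulEquiv.injective
  apply powIncl_injective
  rw [powIncl_beta]
  have := powIncl_sigmaAt σ (p := powOne) (q := powOne) (c := x ⊗ₜ y) (N := 2) (i := 0) (r := 0)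
    (x := TensorPower.mulEquiv (oneEquiv x ⊗ₜ oneEquiv y)) rfl (by
      rw [powIncl_powOne, one_mul, mul_one]
      rfl)
  rw [powIncl_powOne, one_mul, mul_one] at this
  rw [show betaWord σ 1 1 = sigmaAt σ 2 0 by simp [betaWord, sigmaRow]]
  exact this

/-- This hexagon is visible on the word: its last `b` rows act first, on the last `b + n` factors,
as the word of `beta σ b n`, and the remaining `a` rows then act on the first `a + n` factors as
that of `beta σ a n`. -/
theorem beta_add_left (a b n : ℕ) :
    Intertwines (crossL (beta σ a n) (beta σ b n)) (beta σ (a + b) n)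
      TensorPower.mulEquiv.toLinearMap LinearMap.id := by
  refine TensorProduct.ext_threefold fun x x' y => ?_
  apply TensorPower.mulEquiv.injective
  apply powIncl_injective
  simp only [LinearMap.comp_apply, TensorProduct.map_tmul, LinearEquiv.coe_coe, LinearMap.id_apply]
  rw [powIncl_beta, crossL_tmul]
  have h₁ : betaWord σ (a + b) n = ((List.range a).map fun i => sigmaRow σ (a + b + n) n i).prod *
      ((List.range b).map fun i => sigmaRow σ (a + b + n) n (a + i)).prod := by
    rw [betaWord, List.range_add, List.map_append, List.prod_append, List.map_map]
    rfl
  have h₂ : ActsOnLast a ((List.range b).map fun i => sigmaRow σ (a + b + n) n (a + i)).prod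
      (betaWord σ b n) := ActsOnLast.list_prod _ fun j hj => by
    rw [List.mem_range] at hj
    exact actsOnLast_sigmaRow σ (by omega) (by omega)
  have h₃ : ActsOnFirst b ((List.range a).map fun i => sigmaRow σ (a + b + n) n i).prod
      (betaWord σ a n) := ActsOnFirst.list_prod _ fun j hj => by
    rw [List.mem_range] at hj
    exact actsOnFirst_sigmaRow σ (by omega) (by omega)
  rw [h₁, Module.End.mul_apply]
  have h₄ : ∀ s : ⨂[k]^n A ⊗[k] ⨂[k]^a A, ∀ z : ⨂[k]^b A,
      powIncl (n + a) (TensorPower.mulEquiv s) * powIncl b z =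
        powIncl (n + (a + b)) (TensorPower.mulEquiv
          (TensorProduct.map LinearMap.id TensorPower.mulEquiv.toLinearMap
            (TensorProduct.assoc k _ _ _ (s ⊗ₜ z)))) := fun s z => by
    induction s with
    | zero => simp
    | add s t hs ht => simp only [TensorProduct.add_tmul, map_add, add_mul, hs, ht]
    | tmul y x => simp [powIncl_mulEquiv, mul_assoc]
  have h₅ : ∀ t : ⨂[k]^n A ⊗[k] ⨂[k]^b A, powIncl (a + b + n)
      (((List.range a).map fun i => sigmaRow σ (a + b + n) n i).prod
        (TensorPower.cast k A (by omega) (TensorPower.mulEquiv (x ⊗ₜ TensorPower.mulEquiv t)))) =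
      powIncl (n + (a + b)) (TensorPower.mulEquiv
        (TensorProduct.map LinearMap.id TensorPower.mulEquiv.toLinearMap
          (TensorProduct.assoc k _ _ _ ((beta σ a n).rTensor _
            ((TensorProduct.assoc k _ _ _).symm (x ⊗ₜ t)))))) := fun t => by
    induction t with
    | zero => simp
    | add s t hs ht => simp only [TensorProduct.tmul_add, map_add, hs, ht]
    | tmul y z =>
      rw [TensorProduct.assoc_symm_tmul, LinearMap.rTensor_tmul, ← h₄, powIncl_beta]
      exact h₃ _ _ _ (by simp only [powIncl_cast, powIncl_mulEquiv, mul_assoc])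
  have h₆ := h₂ (TensorPower.mulEquiv (TensorPower.mulEquiv (x ⊗ₜ x') ⊗ₜ y)) x
    (TensorPower.mulEquiv (x' ⊗ₜ y)) (by simp only [powIncl_mulEquiv, mul_assoc])
  rw [← powIncl_beta] at h₆
  rw [eq_cast_mulEquiv (by omega) h₆, h₅]

/-- For a single moving factor the word is one row, and `sigmaRow_add` splits it. -/
theorem beta_one_add (m n : ℕ) :
    Intertwines (crossR (beta σ 1 m) (beta σ 1 n)) (beta σ 1 (m + n))
      LinearMap.id TensorPower.mulEquiv.toLinearMap := by
  refine TensorProduct.ext_threefold' fun x y z => ?_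
  apply TensorPower.mulEquiv.injective
  apply powIncl_injective
  simp only [LinearMap.comp_apply, TensorProduct.map_tmul, LinearEquiv.coe_coe, LinearMap.id_apply]
  rw [powIncl_beta, crossR_tmul, betaWord_one, sigmaRow_add, Module.End.mul_apply]
  have h₁ : ActsOnFirst n (sigmaRow σ (1 + (m + n)) m 0) (betaWord σ 1 m) := by
    rw [betaWord_one]
    exact actsOnFirst_sigmaRow σ (by omega) (by omega)
  have h₂ : ActsOnLast m (sigmaRow σ (1 + (m + n)) n (m + 0)) (betaWord σ 1 n) := by
    rw [betaWord_one]
    exact actsOnLast_sigmaRow σ (by omega) (by omega)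
  have h₃ : ∀ (y : ⨂[k]^m A) (s : ⨂[k]^n A ⊗[k] ⨂[k]^1 A),
      powIncl m y * powIncl (n + 1) (TensorPower.mulEquiv s) =
        powIncl (m + n + 1) (TensorPower.mulEquiv
          (TensorProduct.map TensorPower.mulEquiv.toLinearMap LinearMap.id
            ((TensorProduct.assoc k _ _ _).symm (y ⊗ₜ s)))) := fun y s => by
    induction s with
    | zero => simp
    | add s t hs ht => simp only [TensorProduct.tmul_add, map_add, mul_add, hs, ht]
    | tmul z x => simp [powIncl_mulEquiv, mul_assoc]
  have h₄ : ∀ t : ⨂[k]^m A ⊗[k] ⨂[k]^1 A, powIncl (1 + (m + n))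
      (sigmaRow σ (1 + (m + n)) n (m + 0)
        (TensorPower.cast k A (by omega) (TensorPower.mulEquiv (TensorPower.mulEquiv t ⊗ₜ z)))) =
      powIncl (m + n + 1) (TensorPower.mulEquiv
        (TensorProduct.map TensorPower.mulEquiv.toLinearMap LinearMap.id
          ((TensorProduct.assoc k _ _ _).symm ((beta σ 1 n).lTensor _
            (TensorProduct.assoc k _ _ _ (t ⊗ₜ z)))))) := fun t => by
    induction t with
    | zero => simp
    | add s t hs ht => simp only [TensorProduct.add_tmul, map_add, hs, ht]
    | tmul y x =>
      rw [TensorProduct.assoc_tmul, LinearMap.lTensor_tmul, ← h₃, powIncl_beta]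
      exact h₂ _ _ _ (by simp only [powIncl_cast, powIncl_mulEquiv, mul_assoc])
  have h₅ := h₁ (TensorPower.mulEquiv (x ⊗ₜ TensorPower.mulEquiv (y ⊗ₜ z)))
    (TensorPower.mulEquiv (x ⊗ₜ y)) z (by simp only [powIncl_mulEquiv, mul_assoc])
  rw [← powIncl_beta] at h₅
  rw [eq_cast_mulEquiv (by omega) h₅, h₄]

theorem beta_zero_add (m n : ℕ) :
    Intertwines (crossR (beta σ 0 m) (beta σ 0 n)) (beta σ 0 (m + n))
      LinearMap.id TensorPower.mulEquiv.toLinearMap := by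
  refine TensorProduct.ext_threefold' fun x y z => ?_
  obtain ⟨c, rfl⟩ := exists_smul_powOne x
  simp [← TensorProduct.smul_tmul', crossR_tmul, beta_zero_left]

/-- For general `a` the word interleaves the crossings with the two blocks. Induction on `a` avoids
reordering it: `A^{⊗(a+1)}` is the image of `A^{⊗a} ⊗ A^{⊗1}`, and `intertwines_right_of_surjective`
transfers the hexagon from these two factors. -/
theorem beta_add_right (a m n : ℕ) :
    Intertwines (crossR (beta σ a m) (beta σ a n)) (beta σ a (m + n))
      LinearMap.id TensorPower.mulEquiv.toLinearMap := by
  induction a with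
  | zero => exact beta_zero_add σ m n
  | succ a ih =>
    exact intertwines_right_of_surjective TensorPower.mulEquiv.surjective (beta_add_left σ a 1 m)
      (beta_add_left σ a 1 n) (beta_add_left σ a 1 (m + n)) ih (beta_one_add σ m n)

end TensorPowerCrossings

section Naturality

variable {k : Type u} [CommRing k] {A : Type v} [AddCommGroup A] [Module k A]
  (σ : A ⊗[k] A →ₗ[k] A ⊗[k] A)

/-! ### Maps of tensor powers that commute with the crossings -/

/-- `f` commutes with the crossings of its domain and its codomain with all tensor powers. -/
def IsNatural {a b : ℕ} (f : ⨂[k]^a A →ₗ[k] ⨂[k]^b A) : Prop :=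
  ∀ p, Intertwines (beta σ a p) (beta σ b p) f LinearMap.id ∧
    Intertwines (beta σ p a) (beta σ p b) LinearMap.id f

variable {σ}

/-- The hexagons compose the crossing with `A^{⊗(p+1)}` from those with `A^{⊗p}` and `A^{⊗1}`; the
crossing with `A^{⊗0}` is trivial. -/
theorem isNatural_of_one {a b : ℕ} {f : ⨂[k]^a A →ₗ[k] ⨂[k]^b A}
    (h₁ : Intertwines (beta σ a 1) (beta σ b 1) f LinearMap.id)
    (h₂ : Intertwines (beta σ 1 a) (beta σ 1 b) LinearMap.id f) : IsNatural σ f := by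
  intro p
  induction p with
  | zero =>
    constructor
    · refine intertwines_of_apply fun x y => ?_
      obtain ⟨c, rfl⟩ := exists_smul_powOne y
      simp [beta_zero_right]
    · refine intertwines_of_apply fun y x => ?_
      obtain ⟨c, rfl⟩ := exists_smul_powOne y
      simp [← TensorProduct.smul_tmul', beta_zero_left]
  | succ p ih =>
    exact ⟨ih.1.right_of_surjective h₁ (beta_add_right σ a p 1) (beta_add_right σ b p 1) (by simp)
      TensorPower.mulEquiv.surjective, ih.2.left_of_surjective h₂ (beta_add_left σ p 1 a)
      (beta_add_left σ p 1 b) (by simp) TensorPower.mulEquiv.surjective⟩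

theorem IsNatural.comp {a b c : ℕ} {g : ⨂[k]^b A →ₗ[k] ⨂[k]^c A} {f : ⨂[k]^a A →ₗ[k] ⨂[k]^b A}
    (hg : IsNatural σ g) (hf : IsNatural σ f) : IsNatural σ (g ∘ₗ f) :=
  fun p => ⟨by simpa using (hg p).1.comp (hf p).1, by simpa using (hg p).2.comp (hf p).2⟩

theorem IsNatural.id (a : ℕ) : IsNatural σ (LinearMap.id : ⨂[k]^a A →ₗ[k] ⨂[k]^a A) :=
  fun _ => ⟨Intertwines.id _, Intertwines.id _⟩

theorem IsNatural.zero (a b : ℕ) : IsNatural σ (0 : ⨂[k]^a A →ₗ[k] ⨂[k]^b A) :=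
  fun _ => ⟨Intertwines.zero_left _ _ _, Intertwines.zero_right _ _ _⟩

theorem IsNatural.cast {a b : ℕ} (h : a = b) :
    IsNatural σ (TensorPower.cast k A h).toLinearMap := by
  subst h
  rw [TensorPower.cast_refl]
  exact IsNatural.id a

theorem IsNatural.list_prod {a : ℕ} (l : List ℕ) {f : ℕ → Module.End k (⨂[k]^a A)}
    (h : ∀ j, IsNatural σ (f j)) : IsNatural σ (l.map f).prod := by
  induction l with
  | nil => exact IsNatural.id a
  | cons j l ih =>
    rw [List.map_cons, List.prod_cons]
    exact (h j).comp ih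

/-- By the hexagons, crossing a concatenation means crossing its two blocks in turn, so each of `f`
and `g` slides through its own block. -/
theorem IsNatural.mul {a b a' b' : ℕ} {f : ⨂[k]^a A →ₗ[k] ⨂[k]^a' A}
    {g : ⨂[k]^b A →ₗ[k] ⨂[k]^b' A} (hf : IsNatural σ f) (hg : IsNatural σ g) :
    IsNatural σ (TensorPower.mulEquiv.toLinearMap ∘ₗ TensorProduct.map f g ∘ₗ
      TensorPower.mulEquiv.symm.toLinearMap) := by
  intro p
  constructor
  · refine (hf p).1.left_of_surjective (hg p).1 (beta_add_left σ a b p) (beta_add_left σ a' b' p)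
      ?_ TensorPower.mulEquiv.surjective
    ext
    simp
  · refine (hf p).2.right_of_surjective (hg p).2 (beta_add_right σ p a b)
      (beta_add_right σ p a' b') ?_ TensorPower.mulEquiv.surjective
    ext
    simp

theorem intertwines_oneEquiv : Intertwines σ (beta σ 1 1) (oneEquiv (k := k)).toLinearMap
    (oneEquiv (k := k)).toLinearMap :=
  intertwines_of_apply fun x y => (beta_one_one σ x y).symm

theorem intertwines_twoEquiv_left : Intertwines (crossL σ σ) (beta σ 2 1)
    (twoEquiv (k := k)).toLinearMap (oneEquiv (k := k)).toLinearMap :=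
  (beta_add_left σ 1 1 1).comp (intertwines_oneEquiv.crossL intertwines_oneEquiv)

theorem intertwines_twoEquiv_right : Intertwines (crossR σ σ) (beta σ 1 2)
    (oneEquiv (k := k)).toLinearMap (twoEquiv (k := k)).toLinearMap :=
  (beta_add_right σ 1 1 1).comp (intertwines_oneEquiv.crossR intertwines_oneEquiv)

/-- By `isNatural_of_one` only a single strand has to be crossed, and there the claim is
compatibility transported along `oneEquiv` and `twoEquiv`. -/
theorem IsBraidedOp.isNatural {μ : A ⊗[k] A →ₗ[k] A} (h : IsBraidedOp μ σ) :
    IsNatural σ ((oneEquiv.toLinearMap ∘ₗ μ) ∘ₗ twoEquiv.symm.toLinearMap) := by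
  rw [isBraidedOp_iff] at h
  refine isNatural_of_one ?_ ?_
  · have := (intertwines_oneEquiv.comp h.1).comp intertwines_twoEquiv_left.symm
    simpa using this
  · have := (intertwines_oneEquiv.comp h.2).comp intertwines_twoEquiv_right.symm
    simpa using this

theorem IsBraiding.isNatural (h : IsBraiding σ) :
    IsNatural σ ((twoEquiv.toLinearMap ∘ₗ σ) ∘ₗ twoEquiv.symm.toLinearMap) := by
  refine isNatural_of_one ?_ ?_
  · have := (intertwines_twoEquiv_left.comp h.intertwines_left).comp intertwines_twoEquiv_left.symm
    simpa using this
  · have := (intertwines_twoEquiv_right.comp (isBraiding_iff.1 h)).comp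
      intertwines_twoEquiv_right.symm
    simpa using this

theorem IsNatural.opAt {j : ℕ} {f : A ⊗[k] A →ₗ[k] ⨂[k]^j A}
    (h : IsNatural σ (f ∘ₗ twoEquiv.symm.toLinearMap)) (i r : ℕ) : IsNatural σ (opAt f i r) :=
  ((IsNatural.id i).mul h).mul (IsNatural.id r)

theorem IsBraiding.isNatural_sigmaAt (h : IsBraiding σ) (N i : ℕ) :
    IsNatural σ (sigmaAt σ N i) := by
  rw [sigmaAt]
  split
  · exact (IsNatural.cast _).comp ((h.isNatural.opAt _ _).comp (IsNatural.cast _))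
  -- Outside the range `sigmaAt` is `0`, which is natural, so no bound on `i` is needed.
  · exact IsNatural.zero N N

theorem IsBraiding.isNatural_betaWord (h : IsBraiding σ) (m n : ℕ) :
    IsNatural σ (betaWord σ m n) :=
  IsNatural.list_prod _ fun _ => IsNatural.list_prod _ fun _ => h.isNatural_sigmaAt _ _

/-- The Yang–Baxter equation for the crossings of tensor powers. -/
theorem IsBraiding.intertwines_beta (h : IsBraiding σ) (p m n : ℕ) :
    Intertwines (crossR (beta σ p m) (beta σ p n)) (crossR (beta σ p n) (beta σ p m))
      LinearMap.id (beta σ m n) := by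
  -- The word is natural, and the hexagon on its source (here) and on its target (`h₂`) turns the
  -- crossing with the whole power into crossings with its two blocks.
  have h₁ := ((((IsNatural.cast (Nat.add_comm m n)).comp (h.isNatural_betaWord m n)) p).2.comp
      (beta_add_right σ p m n))
  have h₂ := Intertwines.symm (f := LinearEquiv.refl k (⨂[k]^p A)) (beta_add_right σ p n m)
  have h₃ := h₂.comp h₁
  rw [LinearMap.id_comp] at h₃
  exact h₃

/-- Each branch of `join` is natural: a cast after concatenation, the product applied at one place,
or zero. -/
theorem IsBraidedOp.isNatural_join {μ : A ⊗[k] A →ₗ[k] A} (h : IsBraidedOp μ σ) (m n r : ℕ) :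
    IsNatural σ (join μ m n r ∘ₗ TensorPower.mulEquiv.symm.toLinearMap) := by
  have e : (TensorPower.mulEquiv (R := k) (M := A) (n := m) (m := n)).toLinearMap ∘ₗ
      TensorPower.mulEquiv.symm.toLinearMap = LinearMap.id := by
    simp
  rw [join]
  split
  · rw [LinearMap.comp_assoc, e, LinearMap.comp_id]
    exact IsNatural.cast _
  · split
    · simp only [LinearMap.comp_assoc]
      rw [e, LinearMap.comp_id]
      exact (IsNatural.cast _).comp ((h.isNatural.opAt _ _).comp (IsNatural.cast _))
    · rw [LinearMap.zero_comp]
      exact IsNatural.zero _ _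

theorem IsBraidedOp.intertwines_join_left {μ : A ⊗[k] A →ₗ[k] A} (h : IsBraidedOp μ σ)
    (m n r p : ℕ) : Intertwines (crossL (beta σ m p) (beta σ n p)) (beta σ r p)
      (join μ m n r) LinearMap.id := by
  have := ((h.isNatural_join m n r) p).1.comp (beta_add_left σ m n p)
  simpa [LinearMap.comp_assoc] using this

theorem IsBraidedOp.intertwines_join_right {μ : A ⊗[k] A →ₗ[k] A} (h : IsBraidedOp μ σ)
    (m n r p : ℕ) : Intertwines (crossR (beta σ p m) (beta σ p n)) (beta σ p r)
      LinearMap.id (join μ m n r) := by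
  have := ((h.isNatural_join m n r) p).2.comp (beta_add_right σ p m n)
  simpa [LinearMap.comp_assoc] using this

end Naturality

-- Intertwiners on images, and sums of intertwiners

section Crossings

variable {k : Type*} [CommRing k]
  {W X W' X' W'' X'' : Type*} [AddCommGroup W] [Module k W] [AddCommGroup X] [Module k X]
  [AddCommGroup W'] [Module k W'] [AddCommGroup X'] [Module k X']
  [AddCommGroup W''] [Module k W''] [AddCommGroup X''] [Module k X'']

/-- Unlike `Intertwines.cancel`, this asks for no surjectivity and concludes only on images. It
suits the inclusions of single summands, which together span. -/
theorem Intertwines.cancel_apply {β : X ⊗[k] W →ₗ[k] W ⊗[k] X}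
    {β' : X' ⊗[k] W' →ₗ[k] W' ⊗[k] X'} {β'' : X'' ⊗[k] W'' →ₗ[k] W'' ⊗[k] X''}
    {f : X →ₗ[k] X'} {q : W →ₗ[k] W'} {f' : X' →ₗ[k] X''} {q' : W' →ₗ[k] W''}
    (h : Intertwines β β' f q) (h' : Intertwines β β'' (f' ∘ₗ f) (q' ∘ₗ q)) (x : X) (y : W) :
    TensorProduct.map q' f' (β' (f x ⊗ₜ q y)) = β'' (f' (f x) ⊗ₜ q' (q y)) := by
  have := h'.apply x y
  rwa [TensorProduct.map_comp, LinearMap.comp_apply, h.apply] at this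

theorem Intertwines.list_sum_left {β : X ⊗[k] W →ₗ[k] W ⊗[k] X}
    {β' : X' ⊗[k] W' →ₗ[k] W' ⊗[k] X'} {q : W →ₗ[k] W'} {l : List (X →ₗ[k] X')}
    (h : ∀ f ∈ l, Intertwines β β' f q) : Intertwines β β' l.sum q := by
  induction l with
  | nil => exact Intertwines.zero_left β β' q
  | cons f l ih =>
    have h₁ := h f (by simp)
    have h₂ := ih fun g hg => h g (by simp [hg])
    rw [Intertwines] at *
    rw [List.sum_cons, TensorProduct.map_add_right, TensorProduct.map_add_left,
      LinearMap.add_comp, LinearMap.comp_add, h₁, h₂]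

theorem Intertwines.list_sum_right {β : X ⊗[k] W →ₗ[k] W ⊗[k] X}
    {β' : X' ⊗[k] W' →ₗ[k] W' ⊗[k] X'} {f : X →ₗ[k] X'} {l : List (W →ₗ[k] W')}
    (h : ∀ q ∈ l, Intertwines β β' f q) : Intertwines β β' f l.sum := by
  induction l with
  | nil => exact Intertwines.zero_right β β' f
  | cons q l ih =>
    have h₁ := h q (by simp)
    have h₂ := ih fun g hg => h g (by simp [hg])
    rw [Intertwines] at *
    rw [List.sum_cons, TensorProduct.map_add_right, TensorProduct.map_add_left,
      LinearMap.add_comp, LinearMap.comp_add, h₁, h₂]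

end Crossings

/-! ### The braiding of the space of lush trees -/

section LushBraiding

variable {k : Type u} [CommRing k] {A : Type v} [AddCommGroup A] [Module k A]

theorem LushSpace.induction {motive : LushSpace k A → Prop} (x : LushSpace k A)
    (zero : motive 0) (add : ∀ x y, motive x → motive y → motive (x + y))
    (incl : ∀ T x, motive (incl k A T x)) : motive x :=
  DirectSum.induction_on x zero incl add

theorem braiding_incl (σ : A ⊗[k] A →ₗ[k] A ⊗[k] A) (S T : LushTree Unit) :
    Intertwines (beta σ S.deg T.deg) (braiding σ) (incl k A S) (incl k A T) :=
  intertwines_of_apply fun x y => by simp [braiding, bilin_incl]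

theorem treeOp_comp_incl (μ : A ⊗[k] A →ₗ[k] A)
    (op : LushTree Unit → LushTree Unit → List (LushTree Unit)) (S T : LushTree Unit) :
    treeOp μ op ∘ₗ TensorProduct.map (incl k A S) (incl k A T) =
      ((op S T).map fun U => incl k A U ∘ₗ join μ S.deg T.deg U.deg).sum :=
  TensorProduct.ext' fun x y => by
    rw [LinearMap.comp_apply, TensorProduct.map_tmul, treeOp, bilin_incl]

theorem IsBraiding.braiding {σ : A ⊗[k] A →ₗ[k] A ⊗[k] A} (h : IsBraiding σ) :
    IsBraiding (braiding σ) := by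
  rw [isBraiding_iff]
  refine TensorProduct.ext_threefold' fun x y z => ?_
  induction x using LushSpace.induction with
  | zero => simp
  | add x x' hx hx' => simp only [TensorProduct.add_tmul, map_add, hx, hx']
  | incl S x =>
  induction y using LushSpace.induction with
  | zero => simp
  | add y y' hy hy' => simp only [TensorProduct.tmul_add, TensorProduct.add_tmul, map_add, hy, hy']
  | incl T y =>
  induction z using LushSpace.induction with
  | zero => simp
  | add z z' hz hz' => simp only [TensorProduct.tmul_add, map_add, hz, hz']
  | incl U z =>
    have h₁ := (braiding_incl σ S T).crossR (braiding_incl σ S U)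
    have h₂ := (braiding_incl σ S U).crossR (braiding_incl σ S T)
    have h₃ := h₂.comp (h.intertwines_beta S.deg T.deg U.deg)
    -- Rewrites the second map of `h₃` as `braiding σ` after the inclusions, the factorisation
    -- through `h₁` that is to be cancelled.
    rw [braiding_incl σ T U, LinearMap.comp_id, ← LinearMap.id_comp (incl k A S)] at h₃
    exact h₁.cancel_apply h₃ x (y ⊗ₜ z)

/-- Shapes are inert under the braiding. On a pair of summands the product is a sum of maps `incl V
∘ join`, each of which commutes with crossings, so the choice of trees in `op` plays no role. -/
theorem IsBraidedOp.treeOp {μ : A ⊗[k] A →ₗ[k] A} {σ : A ⊗[k] A →ₗ[k] A ⊗[k] A}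
    (h : IsBraidedOp μ σ) (op : LushTree Unit → LushTree Unit → List (LushTree Unit)) :
    IsBraidedOp (treeOp μ op) (BraidedTridend.braiding σ) := by
  rw [isBraidedOp_iff]
  constructor
  · refine TensorProduct.ext_threefold fun y z x => ?_
    induction x using LushSpace.induction with
    | zero => simp
    | add x x' hx hx' => simp only [TensorProduct.tmul_add, map_add, hx, hx']
    | incl S x =>
    induction y using LushSpace.induction with
    | zero => simp
    | add y y' hy hy' => simp only [TensorProduct.add_tmul, map_add, hy, hy']
    | incl T y =>
    induction z using LushSpace.induction with
    | zero => simp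
    | add z z' hz hz' =>
      simp only [TensorProduct.tmul_add, TensorProduct.add_tmul, map_add, hz, hz']
    | incl U z =>
      have h₁ := (braiding_incl σ T S).crossL (braiding_incl σ U S)
      have h₂ : Intertwines (crossL (beta σ T.deg S.deg) (beta σ U.deg S.deg))
          (BraidedTridend.braiding σ) (BraidedTridend.treeOp μ op ∘ₗ
            TensorProduct.map (incl k A T) (incl k A U)) (LinearMap.id ∘ₗ incl k A S) := by
        rw [treeOp_comp_incl, LinearMap.id_comp]
        refine Intertwines.list_sum_left fun f hf => ?_
        obtain ⟨V, hV, rfl⟩ := List.mem_map.1 hf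
        have h₂ := (braiding_incl σ V S).comp (h.intertwines_join_left T.deg U.deg V.deg S.deg)
        rwa [LinearMap.comp_id] at h₂
      have h₃ := h₁.cancel_apply h₂ (y ⊗ₜ z) x
      rw [TensorProduct.map_tmul] at h₃
      exact h₃
  · refine TensorProduct.ext_threefold' fun x y z => ?_
    induction x using LushSpace.induction with
    | zero => simp
    | add x x' hx hx' => simp only [TensorProduct.add_tmul, map_add, hx, hx']
    | incl S x =>
    induction y using LushSpace.induction with
    | zero => simp
    | add y y' hy hy' =>
      simp only [TensorProduct.tmul_add, TensorProduct.add_tmul, map_add, hy, hy']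
    | incl T y =>
    induction z using LushSpace.induction with
    | zero => simp
    | add z z' hz hz' => simp only [TensorProduct.tmul_add, map_add, hz, hz']
    | incl U z =>
      have h₁ := (braiding_incl σ S T).crossR (braiding_incl σ S U)
      have h₂ : Intertwines (crossR (beta σ S.deg T.deg) (beta σ S.deg U.deg))
          (BraidedTridend.braiding σ) (LinearMap.id ∘ₗ incl k A S) (BraidedTridend.treeOp μ op ∘ₗ
            TensorProduct.map (incl k A T) (incl k A U)) := by
        rw [treeOp_comp_incl, LinearMap.id_comp]
        refine Intertwines.list_sum_right fun f hf => ?_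
        obtain ⟨V, hV, rfl⟩ := List.mem_map.1 hf
        have h₂ := (braiding_incl σ S V).comp (h.intertwines_join_right T.deg U.deg V.deg S.deg)
        rwa [LinearMap.comp_id] at h₂
      have h₃ := h₁.cancel_apply h₂ x (y ⊗ₜ z)
      rw [TensorProduct.map_tmul] at h₃
      exact h₃

theorem emb_injective : Function.Injective (emb k A) := by
  exact (DirectSum.of_injective (β := fun T : LushTree Unit => ⨂[k]^(T.deg) A) _).comp
    oneEquiv.injective

theorem preservesBraiding_emb (σ : A ⊗[k] A →ₗ[k] A ⊗[k] A) :
    PreservesBraiding σ (braiding σ) (emb k A) :=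
  (braiding_incl σ (LushTree.single ()) (LushTree.single ())).comp intertwines_oneEquiv

theorem preservesOp_emb (μ : A ⊗[k] A →ₗ[k] A) : PreservesOp μ (dot μ) (emb k A) := by
  refine TensorProduct.ext' fun a b => ?_
  rw [LinearMap.comp_apply, LinearMap.comp_apply, TensorProduct.map_tmul, emb_apply, emb_apply,
    emb_apply, dot_mk]
  -- The facing branches are both `|`, so the two decorations merge and a single tree results.
  have : LushTree.dot (fun a b => μ (a ⊗ₜ b)) (LushTree.single a) (LushTree.single b) =
      [LushTree.single (μ (a ⊗ₜ b))] := by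
    apply List.map_injective_iff.2 Subtype.val_injective
    rw [LushTree.dot, List.attachWith_map_subtype_val]
    rfl
  rw [this]
  simp

end LushBraiding

/-! ### The products of decorated trees satisfy the tridendriform identities -/

section Trees

variable {X : Type u} {M : Type v} [AddCommMonoid M]

/-- The sum of the values of `F` on the entries of `L`. -/
def lsum {Y : Type u} (L : List Y) (F : Y → M) : M := (L.map F).sum

section

variable {Y Z : Type u}

@[simp] theorem lsum_nil (F : Y → M) : lsum [] F = 0 := rfl

@[simp] theorem lsum_cons (T : Y) (L : List Y) (F : Y → M) :
    lsum (T :: L) F = F T + lsum L F := by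
  simp [lsum]

@[simp] theorem lsum_append (L L' : List Y) (F : Y → M) :
    lsum (L ++ L') F = lsum L F + lsum L' F := by
  simp [lsum]

@[simp] theorem lsum_map (L : List Y) (g : Y → Z) (F : Z → M) :
    lsum (L.map g) F = lsum L fun U => F (g U) := by
  simp [lsum, Function.comp_def]

theorem lsum_congr {L : List Y} {F G : Y → M} (h : ∀ U ∈ L, F U = G U) : lsum L F = lsum L G := by
  rw [lsum, lsum, List.map_congr_left h]

theorem lsum_add (L : List Y) (F G : Y → M) :
    lsum L (fun U => F U + G U) = lsum L F + lsum L G := by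
  induction L with
  | nil => simp
  | cons T L ih => rw [lsum_cons, lsum_cons, lsum_cons, ih]; abel

theorem lsum_zero (L : List Y) : lsum L (fun _ => (0 : M)) = 0 := by
  induction L with
  | nil => simp
  | cons T L ih => rw [lsum_cons, ih, add_zero]

theorem lsum_comm (L : List Y) (L' : List Z) (F : Y → Z → M) :
    lsum L (fun U => lsum L' (F U)) = lsum L' fun V => lsum L fun U => F U V := by
  induction L with
  | nil => simp [lsum_zero]
  | cons T L ih => simp only [lsum_cons, lsum_add, ih]

theorem map_lsum {N : Type w} [AddCommMonoid N] {S : Type*} [FunLike S M N]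
    [AddMonoidHomClass S M N] (f : S) (L : List Y) (F : Y → M) : f (lsum L F) = lsum L fun U => f (F U) := by
  induction L with
  | nil => simp
  | cons T L ih => rw [lsum_cons, lsum_cons, map_add, ih]

end

variable (μ : X → X → X)

/-- Since `b * | = b`, the grafting formula also covers `t = |`; later arguments need no case
distinction on `t`. -/
theorem precL_node (a : PTree X) (x : X) (M : Mid X) (b t : PTree X) :
    precL μ (.node a x M b) t = (star μ b t).map fun U => .node a x M U := by
  cases t <;> simp [precL, star_leaf_right]

theorem succL_node (s c : PTree X) (y : X) (N : Mid X) (d : PTree X) :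
    succL μ s (.node c y N d) = (star μ s c).map fun U => .node U y N d := by
  cases s <;> simp [succL, star_leaf_left]

theorem dotL_node (a : PTree X) (x : X) (M : Mid X) (b c : PTree X) (y : X) (N : Mid X)
    (d : PTree X) :
    dotL μ (.node a x M b) (.node c y N d) = glue μ a x M (star μ b c) y N d b c := by
  rw [dotL]

theorem glue_leaf (a : PTree X) (x : X) (M : Mid X) (L : List (PTree X)) (y : X) (N : Mid X)
    (d : PTree X) : glue μ a x M L y N d .leaf .leaf = [mergeNode μ a x M y N d] := by
  simp [glue]

theorem glue_of_ne {a : PTree X} {x : X} {M : Mid X} {L : List (PTree X)} {y : X} {N : Mid X}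
    {d b c : PTree X} (h : ¬ (b = .leaf ∧ c = .leaf)) :
    glue μ a x M L y N d b c = L.map fun U => .node a x (M.append (.cons U y N)) d := by
  cases b <;> cases c <;> simp_all [glue]

/-- Makes `star_eq` and `glue_of_ne` applicable to the individual terms of a product. -/
theorem ne_leaf_of_mem_star {s t : PTree X} (h : ¬ (s = .leaf ∧ t = .leaf)) :
    ∀ U ∈ star μ s t, U ≠ .leaf := by
  intro U hU
  match s, t with
  | .leaf, t =>
    rw [star_leaf_left, List.mem_singleton] at hU
    subst hU
    exact fun h' => h ⟨rfl, h'⟩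
  | .node a x M b, .leaf =>
    rw [star_leaf_right, List.mem_singleton] at hU
    subst hU
    simp
  | .node a x M b, .node c y N d =>
    rw [star, List.mem_append, List.mem_append, List.mem_map, List.mem_map] at hU
    rcases hU with (⟨V, -, rfl⟩ | ⟨V, -, rfl⟩) | hU
    · simp
    · simp
    · unfold glue at hU
      split at hU
      · rw [List.mem_singleton] at hU
        subst hU
        simp [mergeNode]
      · obtain ⟨V, -, rfl⟩ := List.mem_map.1 hU
        simp

-- Concatenating and merging lists of inner branches

theorem Mid.append_assoc (M N O : Mid X) : (M.append N).append O = M.append (N.append O) := by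
  match M with
  | .nil => rfl
  | .cons T x M => simp [Mid.append, Mid.append_assoc M N O]

theorem Mid.merge_append (x : X) (M : Mid X) (y : X) (N Q : Mid X) :
    Mid.merge μ x M y (N.append Q) =
      ((Mid.merge μ x M y N).1, (Mid.merge μ x M y N).2.append Q) := by
  match M with
  | .nil => rfl
  | .cons T z M => simp [Mid.append, Mid.merge, Mid.merge_append z M y N Q]

theorem Mid.append_merge (x : X) (M : Mid X) (U : PTree X) (y : X) (N : Mid X) (z : X) (O : Mid X) :
    Mid.merge μ x (M.append (.cons U y N)) z O =
      (x, M.append (.cons U (Mid.merge μ y N z O).1 (Mid.merge μ y N z O).2)) := by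
  match M with
  | .nil => rfl
  | .cons T w M => simp [Mid.append, Mid.merge, Mid.append_merge w M U y N z O]

variable {μ}

/-- Associativity of `μ` matters only if `N` is empty, when one decoration is merged on both sides.
Otherwise the second merge happens further right. -/
theorem Mid.merge_mul (hμ : ∀ x y z, μ (μ x y) z = μ x (μ y z)) (x y : X) (N : Mid X) (z : X)
    (O : Mid X) :
    Mid.merge μ (μ x y) N z O = (μ x (Mid.merge μ y N z O).1, (Mid.merge μ y N z O).2) := by
  cases N <;> simp [Mid.merge, hμ]

theorem Mid.merge_merge (hμ : ∀ x y z, μ (μ x y) z = μ x (μ y z)) (x : X) (M : Mid X) (y : X)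
    (N : Mid X) (z : X) (O : Mid X) :
    Mid.merge μ (Mid.merge μ x M y N).1 (Mid.merge μ x M y N).2 z O =
      Mid.merge μ x M (Mid.merge μ y N z O).1 (Mid.merge μ y N z O).2 := by
  match M with
  | .nil => simp [Mid.merge, Mid.merge_mul hμ]
  | .cons T w M => simp [Mid.merge, Mid.merge_merge hμ w M y N z O]

-- The seven identities for trees, and associativity of `star`

/-- The product `star` of `s`, `t` and `u` is associative, in the form of sums of arbitrary
functions. -/
def StarAssoc (M : Type v) [AddCommMonoid M] (μ : X → X → X) (s t u : PTree X) : Prop :=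
  ∀ F : PTree X → M, lsum (star μ s t) (fun U => lsum (star μ U u) F) =
    lsum (star μ t u) fun U => lsum (star μ s U) F

theorem lsum_precL_precL {a : PTree X} {x : X} {P : Mid X} {b c : PTree X} {y : X} {N : Mid X}
    {d u : PTree X} (h : StarAssoc M μ b (.node c y N d) u) (F : PTree X → M) :
    lsum (precL μ (.node a x P b) (.node c y N d)) (fun U => lsum (precL μ U u) F) =
      lsum (star μ (.node c y N d) u) fun U => lsum (precL μ (.node a x P b) U) F := by
  simp only [precL_node, lsum_map]
  exact h _

/-- The two products graft at opposite ends of the middle tree, so only the order of summation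
changes. -/
theorem lsum_succL_precL (s c : PTree X) (y : X) (N : Mid X) (d u : PTree X) (F : PTree X → M) :
    lsum (succL μ s (.node c y N d)) (fun U => lsum (precL μ U u) F) =
      lsum (precL μ (.node c y N d) u) fun U => lsum (succL μ s U) F := by
  simp only [precL_node, succL_node, lsum_map]
  exact lsum_comm _ _ _

theorem lsum_succL_succL {s t c : PTree X} {y : X} {N : Mid X} {d : PTree X}
    (h : StarAssoc M μ s t c) (F : PTree X → M) :
    lsum (succL μ t (.node c y N d)) (fun U => lsum (succL μ s U) F) =
      lsum (star μ s t) fun U => lsum (succL μ U (.node c y N d)) F := by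
  simp only [succL_node, lsum_map]
  exact (h _).symm

theorem lsum_dotL_precL (a : PTree X) (x : X) (P : Mid X) (b c : PTree X) (y : X) (N : Mid X)
    (d u : PTree X) (F : PTree X → M) :
    lsum (dotL μ (.node a x P b) (.node c y N d)) (fun U => lsum (precL μ U u) F) =
      lsum (precL μ (.node c y N d) u) fun U => lsum (dotL μ (.node a x P b) U) F := by
  simp only [precL_node, lsum_map, dotL_node]
  by_cases h : b = .leaf ∧ c = .leaf
  · obtain ⟨rfl, rfl⟩ := h
    simp [glue_leaf, mergeNode, precL_node]
  · simp only [glue_of_ne μ h, lsum_map, precL_node]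
    exact lsum_comm _ _ _

theorem lsum_succL_dotL (s c : PTree X) (y : X) (N : Mid X) (d e : PTree X) (z : X) (O : Mid X)
    (f : PTree X) (F : PTree X → M) :
    lsum (succL μ s (.node c y N d)) (fun U => lsum (dotL μ U (.node e z O f)) F) =
      lsum (dotL μ (.node c y N d) (.node e z O f)) fun U => lsum (succL μ s U) F := by
  simp only [succL_node, lsum_map, dotL_node]
  by_cases h : d = .leaf ∧ e = .leaf
  · obtain ⟨rfl, rfl⟩ := h
    simp [glue_leaf, mergeNode, succL_node]
  · simp only [glue_of_ne μ h, lsum_map, succL_node]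
    exact lsum_comm _ _ _

/-- No merge can occur: the branches meeting at the junction include a term of a product with a
nontrivial factor. Both sides graft the triple product of `b`, the middle tree and `e`. -/
theorem lsum_precL_dotL {a : PTree X} {x : X} {P : Mid X} {b c : PTree X} {y : X} {N : Mid X}
    {d e : PTree X} {z : X} {O : Mid X} {f : PTree X} (h : StarAssoc M μ b (.node c y N d) e)
    (F : PTree X → M) :
    lsum (precL μ (.node a x P b) (.node c y N d)) (fun U => lsum (dotL μ U (.node e z O f)) F) =
      lsum (succL μ (.node c y N d) (.node e z O f))
        fun U => lsum (dotL μ (.node a x P b) U) F := by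
  simp only [precL_node, succL_node, lsum_map, dotL_node]
  refine ((lsum_congr fun U hU => ?_).trans
    (h fun W => F (.node a x (P.append (.cons W z O)) f))).trans (lsum_congr fun U hU => ?_)
  · have := ne_leaf_of_mem_star μ (by simp) U hU
    rw [glue_of_ne μ (by simp [this]), lsum_map]
  · have := ne_leaf_of_mem_star μ (by simp) U hU
    rw [glue_of_ne μ (by simp [this]), lsum_map]

/-- There are two junctions, at each of which decorations merge or a product is grafted.
Associativity of `μ` is used when both merge; in the other cases the two operations are independent.
-/
theorem lsum_dotL_dotL (hμ : ∀ x y z, μ (μ x y) z = μ x (μ y z)) (a : PTree X) (x : X) (P : Mid X)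
    (b c : PTree X) (y : X) (N : Mid X) (d e : PTree X) (z : X) (O : Mid X) (f : PTree X)
    (F : PTree X → M) :
    lsum (dotL μ (.node a x P b) (.node c y N d)) (fun U => lsum (dotL μ U (.node e z O f)) F) =
      lsum (dotL μ (.node c y N d) (.node e z O f))
        fun U => lsum (dotL μ (.node a x P b) U) F := by
  simp only [dotL_node]
  by_cases h : b = .leaf ∧ c = .leaf <;> by_cases h' : d = .leaf ∧ e = .leaf
  · obtain ⟨rfl, rfl⟩ := h
    obtain ⟨rfl, rfl⟩ := h'
    simp [glue_leaf, mergeNode, dotL_node, Mid.merge_merge hμ]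
  · obtain ⟨rfl, rfl⟩ := h
    simp [glue_of_ne μ h', glue_leaf, mergeNode, dotL_node, Mid.merge_append]
  · obtain ⟨rfl, rfl⟩ := h'
    simp [glue_of_ne μ h, glue_leaf, mergeNode, dotL_node, Mid.append_merge]
  · simp only [glue_of_ne μ h, glue_of_ne μ h', lsum_map, dotL_node, Mid.append_assoc, Mid.append]
    exact lsum_comm _ _ _

theorem starAssoc (hμ : ∀ x y z, μ (μ x y) z = μ x (μ y z)) (s t u : PTree X) :
    StarAssoc M μ s t u := by
  match s, t, u with
  | .leaf, t, u => intro F; simp [star_leaf_left]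
  | .node a x P b, .leaf, u => intro F; simp [star_leaf_left, star_leaf_right]
  | .node a x P b, .node c y N d, .leaf => intro F; simp [star_leaf_right]
  | .node a x P b, .node c y N d, .node e z O f =>
    intro F
    have h₁ := lsum_precL_precL (a := a) (x := x) (P := P)
      (starAssoc hμ b (.node c y N d) (.node e z O f)) F
    have h₂ := lsum_succL_precL (μ := μ) (.node a x P b) c y N d (.node e z O f) F
    have h₃ := lsum_succL_succL (y := z) (N := O) (d := f)
      (starAssoc hμ (.node a x P b) (.node c y N d) e) F
    have h₄ := lsum_dotL_precL (μ := μ) a x P b c y N d (.node e z O f) F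
    have h₅ := lsum_precL_dotL (a := a) (x := x) (P := P) (z := z) (O := O) (f := f)
      (starAssoc hμ b (.node c y N d) e) F
    have h₆ := lsum_succL_dotL (μ := μ) (.node a x P b) c y N d e z O f F
    have h₇ := lsum_dotL_dotL hμ a x P b c y N d e z O f F
    have hl : lsum (star μ (.node a x P b) (.node c y N d))
        (fun U => lsum (star μ U (.node e z O f)) F) =
        lsum (star μ (.node a x P b) (.node c y N d)) fun U => lsum (precL μ U (.node e z O f)) F +
          lsum (succL μ U (.node e z O f)) F + lsum (dotL μ U (.node e z O f)) F :=
      lsum_congr fun U hU => by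
        rw [star_eq μ (ne_leaf_of_mem_star μ (by simp) U hU) (by simp), lsum_append, lsum_append]
    have hr : lsum (star μ (.node c y N d) (.node e z O f))
        (fun U => lsum (star μ (.node a x P b) U) F) =
        lsum (star μ (.node c y N d) (.node e z O f)) fun U => lsum (precL μ (.node a x P b) U) F +
          lsum (succL μ (.node a x P b) U) F + lsum (dotL μ (.node a x P b) U) F :=
      lsum_congr fun U hU => by
        rw [star_eq μ (by simp) (ne_leaf_of_mem_star μ (by simp) U hU), lsum_append, lsum_append]
    -- The sums `s ≺ (t * u)` and `(s * t) ≻ u` are exchanged whole, before `star` is split, because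
    -- their identities involve the full product. The remaining terms match one by one.
    rw [hl, hr, lsum_add, lsum_add, lsum_add, lsum_add, ← h₁, ← h₃,
      star_eq μ (s := .node a x P b) (t := .node c y N d) (by simp) (by simp),
      star_eq μ (s := .node c y N d) (t := .node e z O f) (by simp) (by simp)]
    simp only [lsum_append]
    rw [h₂, h₄, h₅, h₆, h₇]
    abel
  termination_by sizeOf s + sizeOf t + sizeOf u

end Trees

/-! ### The space of lush trees is tridendriform -/

/-- The list is cut according to the numbers of angles of the branches. Every pure tensor over a
shape therefore comes from a decorated tree. -/
theorem PTree.exists_decoration {X : Type u} (T : PTree Unit) :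
    ∀ l : List X, l.length = T.deg → ∃ s : PTree X, s.shape = T ∧ s.angles = l := by
  refine PTree.rec
    (motive_1 := fun T : PTree Unit => ∀ l : List X, l.length = T.deg →
      ∃ s : PTree X, s.shape = T ∧ s.angles = l)
    (motive_2 := fun M : Mid Unit => ∀ l : List X, l.length = M.angles.length →
      ∃ N : Mid X, (N.map fun _ => ()) = M ∧ N.angles = l) ?_ ?_ ?_ ?_ T
  · intro l hl
    rw [List.length_eq_zero_iff.1 hl]
    exact ⟨.leaf, rfl, rfl⟩
  · intro S x M T hS hM hT l hl
    rw [PTree.deg, PTree.angles, List.length_append, List.length_cons, List.length_append] at hl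
    obtain ⟨p, l, rfl, hp⟩ : ∃ p l', l = p ++ l' ∧ p.length = S.angles.length :=
      ⟨l.take S.angles.length, l.drop _, (List.take_append_drop _ l).symm, by
        rw [List.length_take]; omega⟩
    rw [List.length_append] at hl
    obtain ⟨y, l, rfl⟩ := List.exists_of_length_succ (n := M.angles.length + T.angles.length) l
      (by omega)
    rw [List.length_cons] at hl
    obtain ⟨q, r, rfl, hq⟩ : ∃ q r, l = q ++ r ∧ q.length = M.angles.length :=
      ⟨l.take M.angles.length, l.drop _, (List.take_append_drop _ l).symm, by
        rw [List.length_take]; omega⟩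
    rw [List.length_append] at hl
    obtain ⟨s, rfl, rfl⟩ := hS p hp
    obtain ⟨N, rfl, rfl⟩ := hM q hq
    obtain ⟨t, rfl, rfl⟩ := hT r (by rw [PTree.deg]; omega)
    exact ⟨.node s y N t, rfl, by rw [PTree.angles]⟩
  · intro l hl
    rw [List.length_eq_zero_iff.1 hl]
    exact ⟨.nil, rfl, rfl⟩
  · intro T x M hT hM l hl
    rw [Mid.angles, List.length_append, List.length_cons] at hl
    obtain ⟨p, l, rfl, hp⟩ : ∃ p l', l = p ++ l' ∧ p.length = T.angles.length :=
      ⟨l.take T.angles.length, l.drop _, (List.take_append_drop _ l).symm, by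
        rw [List.length_take]; omega⟩
    rw [List.length_append] at hl
    obtain ⟨y, l, rfl⟩ := List.exists_of_length_succ (n := M.angles.length) l (by omega)
    rw [List.length_cons] at hl
    obtain ⟨s, rfl, rfl⟩ := hT p hp
    obtain ⟨N, rfl, rfl⟩ := hM l (by omega)
    exact ⟨.cons s y N, rfl, by rw [Mid.angles]⟩

section LushTridendriform

variable {k : Type u} [CommRing k] {A : Type v} [AddCommGroup A] [Module k A]

theorem listTensor_of_eq_ofFn {n : ℕ} (v : Fin n → A) {l : List A} (h : l = List.ofFn v)
    (hl : l.length = n) : listTensor n l hl = PiTensorProduct.tprod k v := by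
  subst h
  rw [listTensor, TensorPower.cast_tprod]
  congr 1
  funext i
  simp

theorem exists_mk_eq_incl_tprod (T : LushTree Unit) (v : Fin T.deg → A) :
    ∃ s : LushTree A, s.shape = T ∧ mk s = incl k A T (PiTensorProduct.tprod k v) := by
  obtain ⟨T, hT⟩ := T
  obtain ⟨s, rfl, hs⟩ := T.exists_decoration (List.ofFn v) (by rw [List.length_ofFn]; rfl)
  refine ⟨⟨s, (PTree.lush_map _ s).1 hT.1, (PTree.map_ne_leaf _ s).1 hT.2⟩, rfl, ?_⟩
  exact congrArg (incl k A ⟨s.shape, hT⟩) (listTensor_of_eq_ofFn v hs _)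

variable (k) in
/-- The element of the space of lush trees given by a decorated tree, and `0` if it is not lush. -/
noncomputable def mkTree (s : PTree A) : LushSpace k A :=
  open Classical in if h : s.Lush ∧ s ≠ .leaf then mk ⟨s, h⟩ else 0

theorem mkTree_val (s : LushTree A) : mkTree k s.1 = mk s :=
  dif_pos s.2

theorem LushSpace.tree_induction {motive : LushSpace k A → Prop} (x : LushSpace k A)
    (zero : motive 0) (add : ∀ x y, motive x → motive y → motive (x + y))
    (smul : ∀ (c : k) x, motive x → motive (c • x))
    (tree : ∀ s : PTree A, s.Lush ∧ s ≠ .leaf → motive (mkTree k s)) : motive x := by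
  induction x using LushSpace.induction with
  | zero => exact zero
  | add x y hx hy => exact add x y hx hy
  | incl T x =>
    induction x using PiTensorProduct.induction_on with
    | smul_tprod c v =>
      obtain ⟨s, -, hs⟩ := exists_mk_eq_incl_tprod (k := k) T v
      rw [map_smul, ← hs, ← mkTree_val]
      exact smul _ _ (tree s.1 s.2)
    | add x y hx hy =>
      rw [map_add]
      exact add _ _ hx hy

/-- The product `p` is given on lush trees by the formal sums `P s t` of lush trees. -/
def IsTreeProduct (p : LushSpace k A ⊗[k] LushSpace k A →ₗ[k] LushSpace k A)
    (P : PTree A → PTree A → List (PTree A)) : Prop :=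
  ∀ s t, s.Lush ∧ s ≠ .leaf → t.Lush ∧ t ≠ .leaf → (∀ U ∈ P s t, U.Lush ∧ U ≠ .leaf) ∧
    p (mkTree k s ⊗ₜ mkTree k t) = lsum (P s t) (mkTree k)

theorem sum_attachWith_mk {l : List (PTree A)} (H : ∀ U ∈ l, U.Lush ∧ U ≠ .leaf) :
    ((l.attachWith _ H).map (mk (k := k))).sum = lsum l (mkTree k) := by
  have h : (mk : LushTree A → LushSpace k A) = mkTree k ∘ Subtype.val :=
    funext fun s => (mkTree_val s).symm
  rw [h, ← List.map_map, List.attachWith_map_subtype_val, lsum]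

variable (μ : A ⊗[k] A →ₗ[k] A)

theorem isTreeProduct_prec : IsTreeProduct (prec μ) (precL fun a b => μ (a ⊗ₜ b)) :=
  fun s t hs ht => ⟨lush_precL _ hs ht, by
    rw [mkTree_val ⟨s, hs⟩, mkTree_val ⟨t, ht⟩, prec_mk]
    exact sum_attachWith_mk _⟩

theorem isTreeProduct_succ : IsTreeProduct (succ μ) (succL fun a b => μ (a ⊗ₜ b)) :=
  fun s t hs ht => ⟨lush_succL _ hs ht, by
    rw [mkTree_val ⟨s, hs⟩, mkTree_val ⟨t, ht⟩, succ_mk]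
    exact sum_attachWith_mk _⟩

theorem isTreeProduct_dot : IsTreeProduct (dot μ) (dotL fun a b => μ (a ⊗ₜ b)) :=
  fun s t hs ht => ⟨lush_dotL _ hs ht, by
    rw [mkTree_val ⟨s, hs⟩, mkTree_val ⟨t, ht⟩, dot_mk]
    exact sum_attachWith_mk _⟩

theorem isTreeProduct_star :
    IsTreeProduct (prec μ + succ μ + dot μ) (star fun a b => μ (a ⊗ₜ b)) :=
  fun s t hs ht => ⟨fun U hU => ⟨(lush_star _ hs.1 ht.1 U hU).1,
    (lush_star _ hs.1 ht.1 U hU).2 fun h => hs.2 h.1⟩, by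
    rw [star_eq _ hs.2 ht.2, lsum_append, lsum_append, LinearMap.add_apply, LinearMap.add_apply,
      (isTreeProduct_prec μ s t hs ht).2, (isTreeProduct_succ μ s t hs ht).2,
      (isTreeProduct_dot μ s t hs ht).2]⟩

variable {μ} {p q p' q' : LushSpace k A ⊗[k] LushSpace k A →ₗ[k] LushSpace k A}
  {P Q P' Q' : PTree A → PTree A → List (PTree A)}

theorem lsum_tmul {Y : Type*} (L : List Y) (F : Y → LushSpace k A) (x : LushSpace k A) :
    lsum L F ⊗ₜ[k] x = lsum L fun U => F U ⊗ₜ[k] x := by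
  induction L with
  | nil => simp
  | cons T L ih => rw [lsum_cons, lsum_cons, TensorProduct.add_tmul, ih]

theorem tmul_lsum {Y : Type*} (L : List Y) (F : Y → LushSpace k A) (x : LushSpace k A) :
    x ⊗ₜ[k] lsum L F = lsum L fun U => x ⊗ₜ[k] F U := by
  induction L with
  | nil => simp
  | cons T L ih => rw [lsum_cons, lsum_cons, TensorProduct.tmul_add, ih]

/-- An identity `(x p y) q z = x q' (y p' z)` holds if it holds for trees. -/
theorem IsTreeProduct.identity (hp : IsTreeProduct p P) (hq : IsTreeProduct q Q)
    (hp' : IsTreeProduct p' P') (hq' : IsTreeProduct q' Q')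
    (h : ∀ s t u, s ≠ .leaf → t ≠ .leaf → u ≠ .leaf →
      lsum (P s t) (fun U => lsum (Q U u) (mkTree k)) =
        lsum (P' t u) fun U => lsum (Q' s U) (mkTree k)) (x y z : LushSpace k A) :
    q (p (x ⊗ₜ y) ⊗ₜ z) = q' (x ⊗ₜ p' (y ⊗ₜ z)) := by
  induction x using LushSpace.tree_induction with
  | zero => simp
  | add x x' hx hx' => simp only [TensorProduct.add_tmul, map_add, hx, hx']
  | smul c x hx => simp only [← TensorProduct.smul_tmul', map_smul, hx]
  | tree s hs =>
  induction y using LushSpace.tree_induction with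
  | zero => simp
  | add y y' hy hy' => simp only [TensorProduct.add_tmul, TensorProduct.tmul_add, map_add, hy, hy']
  | smul c y hy => simp only [← TensorProduct.smul_tmul', TensorProduct.tmul_smul, map_smul, hy]
  | tree t ht =>
  induction z using LushSpace.tree_induction with
  | zero => simp
  | add z z' hz hz' => simp only [TensorProduct.tmul_add, map_add, hz, hz']
  | smul c z hz => simp only [TensorProduct.tmul_smul, map_smul, hz]
  | tree u hu =>
    obtain ⟨h₁, h₂⟩ := hp s t hs ht
    obtain ⟨h₃, h₄⟩ := hp' t u ht hu
    rw [h₂, h₄, lsum_tmul, tmul_lsum, map_lsum, map_lsum]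
    refine (lsum_congr fun U hU => ?_).trans ((h s t u hs.2 ht.2 hu.2).trans
      (lsum_congr fun U hU => ?_))
    · exact (hq U u (h₁ U hU) hu).2
    · exact (hq' s U hs (h₃ U hU)).2.symm

theorem isTridendriform (hμ : ∀ x y z : A, μ (μ (x ⊗ₜ y) ⊗ₜ z) = μ (x ⊗ₜ μ (y ⊗ₜ z))) :
    IsTridendriform (prec μ) (succ μ) (dot μ) := by
  have h₁ := isTreeProduct_prec μ
  have h₂ := isTreeProduct_succ μ
  have h₃ := isTreeProduct_dot μ
  have h₄ := isTreeProduct_star μ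
  have key := fun s t u => starAssoc (M := LushSpace k A) (μ := fun a b => μ (a ⊗ₜ b)) hμ s t u
  refine ⟨h₁.identity h₁ h₄ h₁ fun s t u hs ht hu => ?_,
    h₂.identity h₁ h₁ h₂ fun s t u hs ht hu => ?_,
    fun x y z => (h₄.identity h₂ h₂ h₂ (fun s t u hs ht hu => ?_) x y z).symm,
    h₃.identity h₁ h₁ h₃ fun s t u hs ht hu => ?_,
    h₁.identity h₃ h₂ h₃ fun s t u hs ht hu => ?_,
    h₂.identity h₃ h₃ h₂ fun s t u hs ht hu => ?_,
    h₃.identity h₃ h₃ h₃ fun s t u hs ht hu => ?_⟩ <;>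
  cases s <;> cases t <;> cases u <;> first | contradiction | skip
  · exact lsum_precL_precL (key _ _ _) _
  · exact lsum_succL_precL _ _ _ _ _ _ _
  · exact (lsum_succL_succL (key _ _ _) _).symm
  · exact lsum_dotL_precL _ _ _ _ _ _ _ _ _ _
  · exact lsum_precL_dotL (key _ _ _) _
  · exact lsum_succL_dotL _ _ _ _ _ _ _ _ _ _
  · exact lsum_dotL_dotL hμ _ _ _ _ _ _ _ _ _ _ _ _ _

theorem isBraidedTridendriform {σ : A ⊗[k] A →ₗ[k] A ⊗[k] A} (h : IsBraidedAlgebra μ σ) :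
    IsBraidedTridendriform (prec μ) (succ μ) (dot μ) (braiding σ) :=
  ⟨isTridendriform h.assoc, h.braiding.braiding, h.compat.treeOp _, h.compat.treeOp _,
    h.compat.treeOp _⟩

end LushTridendriform

/-! ### Evaluation of decorated trees in a tridendriform algebra -/

section Eval

variable {k : Type u} [CommRing k] {X : Type v} {R : Type w} [AddCommGroup R] [Module k R]

/-- `r ↦ e ≻ r`, where `e` is the value of the tree `T`; the identity if `T = |`. -/
noncomputable def leftAct (su : R ⊗[k] R →ₗ[k] R) : PTree X → R → R →ₗ[k] R
  | .leaf, _ => LinearMap.id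
  | .node _ _ _ _, e => su ∘ₗ TensorProduct.mk k R R e

/-- `r ↦ r ≺ e`, where `e` is the value of the tree `T`; the identity if `T = |`. -/
noncomputable def rightAct (pr : R ⊗[k] R →ₗ[k] R) : PTree X → R → R →ₗ[k] R
  | .leaf, _ => LinearMap.id
  | .node _ _ _ _, e => pr ∘ₗ (TensorProduct.mk k R R).flip e

section

variable (su pr : R ⊗[k] R →ₗ[k] R)

@[simp] theorem leftAct_leaf (e r : R) : leftAct su (.leaf : PTree X) e r = r := rfl

@[simp] theorem rightAct_leaf (e r : R) : rightAct pr (.leaf : PTree X) e r = r := rfl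

theorem leftAct_of_ne {T : PTree X} (h : T ≠ .leaf) (e r : R) :
    leftAct su T e r = su (e ⊗ₜ r) := by
  cases T
  · exact absurd rfl h
  · rfl

theorem rightAct_of_ne {T : PTree X} (h : T ≠ .leaf) (e r : R) :
    rightAct pr T e r = pr (r ⊗ₜ e) := by
  cases T
  · exact absurd rfl h
  · rfl

end

variable (pr su dt : R ⊗[k] R →ₗ[k] R) (ψ : X → R)

mutual
/-- The value of a decorated tree in an algebra with three products, where
`T₀ ∨_{x₁} ⋯ ∨_{x_k} T_k = T₀ ≻ ((x₁ ≺ T₁) · ((x₂ ≺ T₂) · ⋯ (x_k ≺ T_k)))`. -/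
noncomputable def PTree.eval : PTree X → R
  | .leaf => 0
  | .node a x M b => leftAct su a a.eval (M.eval x (rightAct pr b b.eval))
/-- The value of `(x ≺ T₁) · ((x₂ ≺ T₂) · ⋯ f (x_k))`. -/
noncomputable def Mid.eval : Mid X → X → (R → R) → R
  | .nil, x, f => f (ψ x)
  | .cons T z M, x, f => dt (pr (ψ x ⊗ₜ T.eval) ⊗ₜ M.eval z f)
end

variable {pr su dt ψ}

theorem Mid.eval_append_cons (M : Mid X) (x : X) (U : PTree X) (y : X) (N : Mid X) (f : R → R) :
    (M.append (.cons U y N)).eval pr su dt ψ x f =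
      M.eval pr su dt ψ x fun r => dt (pr (r ⊗ₜ U.eval pr su dt ψ) ⊗ₜ N.eval pr su dt ψ y f) := by
  match M with
  | .nil => rw [Mid.append, Mid.eval, Mid.eval]
  | .cons T z M => rw [Mid.append, Mid.eval, Mid.eval, Mid.eval_append_cons M z U y N f]

theorem Mid.eval_lsum (M : Mid X) (x : X) (L : List (PTree X)) (f : PTree X → R → R) :
    lsum L (fun U => M.eval pr su dt ψ x (f U)) =
      M.eval pr su dt ψ x fun r => lsum L fun U => f U r := by
  match M with
  | .nil => simp only [Mid.eval]
  | .cons T z M =>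
    simp only [Mid.eval]
    rw [← Mid.eval_lsum M z L f]
    exact (map_lsum (dt ∘ₗ TensorProduct.mk k R R _) L _).symm

/-- Right multiplication travels down the chain to its last factor by `(x · y) ≺ z = x · (y ≺ z)`.
-/
theorem Mid.eval_prec (h : IsTridendriform pr su dt) (M : Mid X) (x : X) (f : R → R) (t : R) :
    M.eval pr su dt ψ x (fun r => pr (f r ⊗ₜ t)) = pr (M.eval pr su dt ψ x f ⊗ₜ t) := by
  match M with
  | .nil => simp only [Mid.eval]
  | .cons T z M => rw [Mid.eval, Mid.eval, Mid.eval_prec h M z f t, h.dot_prec]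

theorem Mid.eval_dot (h : IsTridendriform pr su dt) (M : Mid X) (x : X) (f : R → R) (t : R) :
    M.eval pr su dt ψ x (fun r => dt (f r ⊗ₜ t)) = dt (M.eval pr su dt ψ x f ⊗ₜ t) := by
  match M with
  | .nil => simp only [Mid.eval]
  | .cons T z M => rw [Mid.eval, Mid.eval, Mid.eval_dot h M z f t, h.dot_dot]

/-- A merged decoration has the value `ψ a · ψ y`, and associativity splits the chain there. If `N`
is empty, the closing map `f` acts on this product, and `hf` moves it to the right factor. -/
theorem Mid.eval_merge (h : IsTridendriform pr su dt) {μ : X → X → X}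
    (hψ : ∀ x y, ψ (μ x y) = dt (ψ x ⊗ₜ ψ y)) (x : X) (M : Mid X) (y : X) (N : Mid X) {f : R → R}
    (hf : ∀ r s, f (dt (r ⊗ₜ s)) = dt (r ⊗ₜ f s)) :
    (Mid.merge μ x M y N).2.eval pr su dt ψ (Mid.merge μ x M y N).1 f =
      dt (M.eval pr su dt ψ x id ⊗ₜ N.eval pr su dt ψ y f) := by
  match M with
  | .nil =>
    cases N with
    | nil => simp [Mid.merge, Mid.eval, hψ, hf]
    | cons T z N => simp [Mid.merge, Mid.eval, hψ, h.dot_dot, h.dot_prec]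
  | .cons T z M =>
    rw [Mid.merge, Mid.eval, Mid.eval, Mid.eval_merge h hψ z M y N hf, h.dot_dot]

theorem leftAct_dot (h : IsTridendriform pr su dt) (T : PTree X) (e r s : R) :
    dt (leftAct su T e r ⊗ₜ s) = leftAct su T e (dt (r ⊗ₜ s)) := by
  cases T
  · rfl
  · exact h.succ_dot e r s

theorem leftAct_prec (h : IsTridendriform pr su dt) (T : PTree X) (e r s : R) :
    pr (leftAct su T e r ⊗ₜ s) = leftAct su T e (pr (r ⊗ₜ s)) := by
  cases T
  · rfl
  · exact h.succ_prec e r s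

theorem rightAct_dot (h : IsTridendriform pr su dt) (T : PTree X) (e r s : R) :
    rightAct pr T e (dt (r ⊗ₜ s)) = dt (r ⊗ₜ rightAct pr T e s) := by
  cases T
  · rfl
  · exact h.dot_prec r s e

theorem lsum_mul {Y : Type*} (p : R ⊗[k] R →ₗ[k] R) (L : List Y) (F : Y → R) (r : R) :
    (lsum L fun U => p (F U ⊗ₜ r)) = p (lsum L F ⊗ₜ r) :=
  (map_lsum (p ∘ₗ (TensorProduct.mk k R R).flip r) L F).symm

theorem mul_lsum {Y : Type*} (p : R ⊗[k] R →ₗ[k] R) (L : List Y) (F : Y → R) (r : R) :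
    (lsum L fun U => p (r ⊗ₜ F U)) = p (r ⊗ₜ lsum L F) :=
  (map_lsum (p ∘ₗ TensorProduct.mk k R R r) L F).symm

-- Multiplicativity of evaluation

/-- The value of the product of `s` and `t`, unless one of them is trivial, is the product of the
values. -/
def EvalMul (pr su dt : R ⊗[k] R →ₗ[k] R) (ψ : X → R) (μ : X → X → X) (s t : PTree X) : Prop :=
  s ≠ .leaf → t ≠ .leaf → lsum (star μ s t) (PTree.eval pr su dt ψ) =
    (pr + su + dt) (s.eval pr su dt ψ ⊗ₜ t.eval pr su dt ψ)

variable {μ : X → X → X}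

theorem EvalMul.lsum_rightAct (h : IsTridendriform pr su dt) {b t : PTree X}
    (hm : EvalMul pr su dt ψ μ b t) (ht : t ≠ .leaf) (r : R) :
    lsum (star μ b t) (fun U => rightAct pr U (U.eval pr su dt ψ) r) =
      pr (rightAct pr b (b.eval pr su dt ψ) r ⊗ₜ t.eval pr su dt ψ) := by
  have : lsum (star μ b t) (fun U => rightAct pr U (U.eval pr su dt ψ) r) =
      lsum (star μ b t) fun U => pr (r ⊗ₜ U.eval pr su dt ψ) := lsum_congr fun U hU =>
    rightAct_of_ne pr (ne_leaf_of_mem_star μ (fun h => ht h.2) U hU) _ _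
  rw [this, mul_lsum]
  by_cases hb : b = .leaf
  · subst hb
    simp [star_leaf_left]
  · rw [hm hb ht, rightAct_of_ne pr hb, h.prec_prec]

theorem EvalMul.lsum_leftAct (h : IsTridendriform pr su dt) {s c : PTree X}
    (hm : EvalMul pr su dt ψ μ s c) (hs : s ≠ .leaf) (r : R) :
    lsum (star μ s c) (fun U => leftAct su U (U.eval pr su dt ψ) r) =
      su (s.eval pr su dt ψ ⊗ₜ leftAct su c (c.eval pr su dt ψ) r) := by
  have : lsum (star μ s c) (fun U => leftAct su U (U.eval pr su dt ψ) r) =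
      lsum (star μ s c) fun U => su (U.eval pr su dt ψ ⊗ₜ r) := lsum_congr fun U hU =>
    leftAct_of_ne su (ne_leaf_of_mem_star μ (fun h => hs h.1) U hU) _ _
  rw [this, lsum_mul]
  by_cases hc : c = .leaf
  · subst hc
    simp [star_leaf_right]
  · rw [hm hs hc, leftAct_of_ne su hc, h.succ_succ]

/-- The computation at a grafted junction is `(r ≺ (b * c)) · s = ((r ≺ b) ≺ c) · s = (r ≺ b) · (c ≻
s)`, with a trivial branch omitted. Two trivial branches are excluded, since the placeholder value
of `|` would enter. -/
theorem EvalMul.lsum_prec_dot (h : IsTridendriform pr su dt) {b c : PTree X}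
    (hm : EvalMul pr su dt ψ μ b c) (hbc : ¬ (b = .leaf ∧ c = .leaf)) (r s : R) :
    lsum (star μ b c) (fun U => dt (pr (r ⊗ₜ U.eval pr su dt ψ) ⊗ₜ s)) =
      dt (rightAct pr b (b.eval pr su dt ψ) r ⊗ₜ leftAct su c (c.eval pr su dt ψ) s) := by
  rw [lsum_mul dt, mul_lsum]
  by_cases hb : b = .leaf
  · subst hb
    rw [leftAct_of_ne su (by simpa using hbc), rightAct_leaf, ← h.prec_dot]
    simp [star_leaf_left]
  · rw [rightAct_of_ne pr hb]
    by_cases hc : c = .leaf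
    · subst hc
      simp [star_leaf_right]
    · rw [hm hb hc, leftAct_of_ne su hc, ← h.prec_dot, h.prec_prec]

/-- The factor `t` slides past `a ≻` and down the chain to the last factor `x_k ≺ b`, where `(x_k ≺
b) ≺ t = x_k ≺ (b * t)`. -/
theorem EvalMul.precL (h : IsTridendriform pr su dt) {a b : PTree X} {x : X} {M : Mid X}
    {t : PTree X} (hm : EvalMul pr su dt ψ μ b t) (ht : t ≠ .leaf) :
    lsum (precL μ (.node a x M b) t) (PTree.eval pr su dt ψ) =
      pr ((PTree.node a x M b).eval pr su dt ψ ⊗ₜ t.eval pr su dt ψ) := by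
  rw [precL_node, lsum_map, PTree.eval, leftAct_prec h, ← Mid.eval_prec h]
  simp only [PTree.eval]
  rw [← map_lsum (leftAct su a (a.eval pr su dt ψ)), Mid.eval_lsum]
  simp only [hm.lsum_rightAct h ht]

theorem EvalMul.succL (h : IsTridendriform pr su dt) {s c d : PTree X} {y : X} {N : Mid X}
    (hm : EvalMul pr su dt ψ μ s c) (hs : s ≠ .leaf) :
    lsum (succL μ s (.node c y N d)) (PTree.eval pr su dt ψ) =
      su (s.eval pr su dt ψ ⊗ₜ (PTree.node c y N d).eval pr su dt ψ) := by
  rw [succL_node, lsum_map]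
  simp only [PTree.eval]
  exact hm.lsum_leftAct h hs _

/-- Once `a ≻` is pulled out, two chains meet at one junction: `Mid.eval_merge` treats the merged
case and `EvalMul.lsum_prec_dot` the grafted one. -/
theorem EvalMul.dotL (h : IsTridendriform pr su dt) (hψ : ∀ x y, ψ (μ x y) = dt (ψ x ⊗ₜ ψ y))
    {a b c d : PTree X} {x y : X} {M N : Mid X} (hm : EvalMul pr su dt ψ μ b c) :
    lsum (dotL μ (.node a x M b) (.node c y N d)) (PTree.eval pr su dt ψ) =
      dt ((PTree.node a x M b).eval pr su dt ψ ⊗ₜ (PTree.node c y N d).eval pr su dt ψ) := by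
  rw [dotL_node]
  simp only [PTree.eval]
  rw [leftAct_dot h]
  by_cases hbc : b = .leaf ∧ c = .leaf
  · obtain ⟨rfl, rfl⟩ := hbc
    rw [glue_leaf, lsum_cons, lsum_nil, add_zero, mergeNode]
    simp only [PTree.eval]
    rw [Mid.eval_merge h hψ _ _ _ _ (rightAct_dot h d _)]
    rfl
  · rw [glue_of_ne μ hbc, lsum_map]
    simp only [PTree.eval]
    rw [← map_lsum (leftAct su a (a.eval pr su dt ψ))]
    simp only [Mid.eval_append_cons]
    rw [Mid.eval_lsum, ← Mid.eval_dot h]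
    simp only [hm.lsum_prec_dot h hbc]

theorem evalMul (h : IsTridendriform pr su dt) (hψ : ∀ x y, ψ (μ x y) = dt (ψ x ⊗ₜ ψ y))
    (s t : PTree X) : EvalMul pr su dt ψ μ s t := by
  match s, t with
  | .leaf, t => exact fun hs => absurd rfl hs
  | .node a x M b, .leaf => exact fun _ ht => absurd rfl ht
  | .node a x M b, .node c y N d =>
    intro hs ht
    rw [star_eq μ hs ht, lsum_append, lsum_append, (evalMul h hψ b (.node c y N d)).precL h ht,
      (evalMul h hψ (.node a x M b) c).succL h hs, (evalMul h hψ b c).dotL h hψ,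
      LinearMap.add_apply, LinearMap.add_apply]
  termination_by sizeOf s + sizeOf t

/-- Homomorphisms commute with evaluation. -/
theorem PTree.map_eval {S : Type*} [AddCommGroup S] [Module k S] {pr' su' dt' : S ⊗[k] S →ₗ[k] S}
    {f : R →ₗ[k] S} (hp : PreservesOp pr pr' f) (hs : PreservesOp su su' f)
    (hd : PreservesOp dt dt' f) (ψ : X → R) (T : PTree X) :
    f (T.eval pr su dt ψ) = T.eval pr' su' dt' fun x => f (ψ x) := by
  have hp' : ∀ r s, f (pr (r ⊗ₜ s)) = pr' (f r ⊗ₜ f s) := fun r s => by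
    simpa using LinearMap.congr_fun hp (r ⊗ₜ s)
  have hs' : ∀ r s, f (su (r ⊗ₜ s)) = su' (f r ⊗ₜ f s) := fun r s => by
    simpa using LinearMap.congr_fun hs (r ⊗ₜ s)
  have hd' : ∀ r s, f (dt (r ⊗ₜ s)) = dt' (f r ⊗ₜ f s) := fun r s => by
    simpa using LinearMap.congr_fun hd (r ⊗ₜ s)
  refine PTree.rec
    (motive_1 := fun T : PTree X => f (T.eval pr su dt ψ) = T.eval pr' su' dt' fun x => f (ψ x))
    (motive_2 := fun M : Mid X => ∀ (x : X) (g : R → R) (g' : S → S), (∀ r, f (g r) = g' (f r)) →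
      f (M.eval pr su dt ψ x g) = M.eval pr' su' dt' (fun x => f (ψ x)) x g') ?_ ?_ ?_ ?_ T
  · simp [PTree.eval]
  · intro a x M b ha hM hb
    have hl : ∀ r, f (leftAct su a (a.eval pr su dt ψ) r) =
        leftAct su' a (a.eval pr' su' dt' fun x => f (ψ x)) (f r) := fun r => by
      rw [← ha]
      cases a
      · rfl
      · exact hs' _ _
    have hr : ∀ r, f (rightAct pr b (b.eval pr su dt ψ) r) =
        rightAct pr' b (b.eval pr' su' dt' fun x => f (ψ x)) (f r) := fun r => by
      rw [← hb]
      cases b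
      · rfl
      · exact hp' _ _
    rw [PTree.eval, PTree.eval, hl, hM x _ _ hr]
  · intro x g g' hg
    rw [Mid.eval, Mid.eval, hg]
  · intro T z M hT hM x g g' hg
    rw [Mid.eval, Mid.eval, hd', hp', hT, hM z g g' hg]

end Eval

/-! ### Decorated trees are generated by the decorations -/

section Generation

variable {k : Type u} [CommRing k] {A : Type v} [AddCommGroup A] [Module k A]
  (μ : A ⊗[k] A →ₗ[k] A)

theorem leftAct_mkTree {a d : PTree A} {y : A} {N : Mid A} (ha : a.Lush)
    (ht : (PTree.node .leaf y N d).Lush) :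
    leftAct (succ μ) a (mkTree k a) (mkTree k (.node .leaf y N d)) = mkTree k (.node a y N d) := by
  by_cases h : a = .leaf
  · subst h
    rfl
  · rw [leftAct_of_ne _ h, (isTreeProduct_succ μ _ _ ⟨ha, h⟩ ⟨ht, by simp⟩).2, succL_node,
      star_leaf_right]
    simp

theorem rightAct_mkTree {x : A} {b : PTree A} (hb : b.Lush) :
    rightAct (prec μ) b (mkTree k b) (mkTree k (.node .leaf x .nil .leaf)) =
      mkTree k (.node .leaf x .nil b) := by
  by_cases h : b = .leaf
  · subst h
    rfl
  · rw [rightAct_of_ne _ h,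
      (isTreeProduct_prec μ (.node .leaf x .nil .leaf) b (LushTree.single x).2 ⟨hb, h⟩).2,
      precL_node, star_leaf_left]
    simp

/-- Lushness is essential: inner branches differ from `|`, so the product of `x ≺ T₁` with the rest
of the chain, whose leftmost branch is `|`, grafts `T₁ * | = T₁` instead of merging decorations. -/
theorem eval_emb (T : PTree A) (hT : T.Lush) (h : T ≠ .leaf) :
    T.eval (prec μ) (succ μ) (dot μ) (emb k A) = mkTree k T := by
  -- The induction hypothesis excludes `|`, but there both actions are the identity, so values may
  -- be replaced by trees in every outer branch.
  have key : ∀ T : PTree A, (T.Lush → T ≠ .leaf →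
      T.eval (prec μ) (succ μ) (dot μ) (emb k A) = mkTree k T) → T.Lush →
      leftAct (succ μ) T (T.eval (prec μ) (succ μ) (dot μ) (emb k A)) =
        leftAct (succ μ) T (mkTree k T) ∧
      rightAct (prec μ) T (T.eval (prec μ) (succ μ) (dot μ) (emb k A)) =
        rightAct (prec μ) T (mkTree k T) := fun T h hT => by
    by_cases hl : T = .leaf
    · subst hl
      exact ⟨rfl, rfl⟩
    · rw [h hT hl]
      exact ⟨rfl, rfl⟩
  refine PTree.rec
    (motive_1 := fun T : PTree A => T.Lush → T ≠ .leaf →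
      T.eval (prec μ) (succ μ) (dot μ) (emb k A) = mkTree k T)
    (motive_2 := fun M : Mid A => ∀ (x : A) (b : PTree A), M.Lush → b.Lush →
      M.eval (prec μ) (succ μ) (dot μ) (emb k A) x (rightAct (prec μ) b (mkTree k b)) =
        mkTree k (.node .leaf x M b)) ?_ ?_ ?_ ?_ T hT h
  · exact fun _ h => absurd rfl h
  · intro a x M b ha hM hb hl _
    have hl' := hl
    rw [PTree.Lush] at hl'
    rw [PTree.eval, (key a ha hl'.1).1, (key b hb hl'.2.2).2, hM x b hl'.2.1 hl'.2.2]
    refine leftAct_mkTree μ hl'.1 ?_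
    rw [PTree.Lush]
    exact ⟨by rw [PTree.Lush]; trivial, hl'.2⟩
  · intro x b _ hb
    rw [Mid.eval, emb_apply, ← mkTree_val]
    exact rightAct_mkTree μ hb
  · intro T z M hT hM x b hl hb
    rw [Mid.Lush] at hl
    have h₁ : (PTree.leaf : PTree A).Lush := by rw [PTree.Lush]; trivial
    have h₂ : (PTree.node .leaf z M b).Lush := by rw [PTree.Lush]; exact ⟨h₁, hl.2.2, hb⟩
    have h₃ : (PTree.node .leaf x .nil T).Lush := by
      rw [PTree.Lush, Mid.Lush]; exact ⟨h₁, trivial, hl.2.1⟩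
    have h₄ := rightAct_mkTree (k := k) μ (x := x) hl.2.1
    rw [rightAct_of_ne _ hl.1] at h₄
    rw [Mid.eval, hM z b hl.2.2 hb, hT hl.2.1 hl.1, emb_apply, ← mkTree_val]
    refine (congrArg (fun r => dot μ (r ⊗ₜ _)) h₄).trans ?_
    rw [(isTreeProduct_dot μ _ _ ⟨h₃, by simp⟩ ⟨h₂, by simp⟩).2, dotL_node,
      glue_of_ne _ (by simp [hl.1]), star_leaf_right]
    simp [Mid.append]

end Generation

/-! ### The homomorphism extending a given one -/

section Extension

variable {k : Type u} [CommRing k] {A : Type v} [AddCommGroup A] [Module k A]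
  {R : Type w} [AddCommGroup R] [Module k R]

/-- The linear maps `A^{⊗n} → R` generated by `ψ` under the three products of `R`. -/
inductive IsGenerated (pr su dt : R ⊗[k] R →ₗ[k] R) (ψ : A →ₗ[k] R) :
    ∀ n, (⨂[k]^n A →ₗ[k] R) → Prop
  | base : IsGenerated pr su dt ψ 1 (ψ ∘ₗ oneEquiv.symm.toLinearMap)
  | mul {m n : ℕ} {φ : ⨂[k]^m A →ₗ[k] R} {χ : ⨂[k]^n A →ₗ[k] R} {p : R ⊗[k] R →ₗ[k] R}
      (hp : p = pr ∨ p = su ∨ p = dt) (hφ : IsGenerated pr su dt ψ m φ)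
      (hχ : IsGenerated pr su dt ψ n χ) : IsGenerated pr su dt ψ (m + n)
        (p ∘ₗ TensorProduct.map φ χ ∘ₗ TensorPower.mulEquiv.symm.toLinearMap)

variable {pr su dt : R ⊗[k] R →ₗ[k] R} {ψ : A →ₗ[k] R}

/-- Multilinear maps given by products commute with the braidings. -/
theorem IsGenerated.intertwines {σ : A ⊗[k] A →ₗ[k] A ⊗[k] A} {τ : R ⊗[k] R →ₗ[k] R ⊗[k] R}
    (hψ : PreservesBraiding σ τ ψ) (hpr : IsBraidedOp pr τ) (hsu : IsBraidedOp su τ)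
    (hdt : IsBraidedOp dt τ) {m n : ℕ} {φ : ⨂[k]^m A →ₗ[k] R} {χ : ⨂[k]^n A →ₗ[k] R}
    (hφ : IsGenerated pr su dt ψ m φ) (hχ : IsGenerated pr su dt ψ n χ) :
    Intertwines (beta σ m n) τ φ χ := by
  have hop : ∀ p, p = pr ∨ p = su ∨ p = dt → IsBraidedOp p τ := by
    rintro p (rfl | rfl | rfl) <;> assumption
  have h₁ : Intertwines (beta σ 1 1) τ (ψ ∘ₗ oneEquiv.symm.toLinearMap)
      (ψ ∘ₗ oneEquiv.symm.toLinearMap) :=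
    Intertwines.comp (β' := σ) hψ intertwines_oneEquiv.symm
  have hmul : ∀ {m n : ℕ} (φ : ⨂[k]^m A →ₗ[k] R) (χ : ⨂[k]^n A →ₗ[k] R) (p : R ⊗[k] R →ₗ[k] R),
      (p ∘ₗ TensorProduct.map φ χ ∘ₗ TensorPower.mulEquiv.symm.toLinearMap) ∘ₗ
        TensorPower.mulEquiv.toLinearMap = p ∘ₗ TensorProduct.map φ χ := fun φ χ p =>
    TensorProduct.ext' fun x y => by simp
  -- Double induction: first `φ` is built up against a single generator by the left hexagon, then
  -- `χ` against the fixed `φ` by the right one.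
  have h₂ : Intertwines (beta σ m 1) τ φ (ψ ∘ₗ oneEquiv.symm.toLinearMap) := by
    clear hχ
    induction hφ with
    | base => exact h₁
    | @mul m n φ χ p hp _ _ ih ih' =>
      exact ih.left_of_surjective ih' (beta_add_left σ m n 1) (isBraidedOp_iff.1 (hop p hp)).1
        (hmul φ χ p) TensorPower.mulEquiv.surjective
  induction hχ with
  | base => exact h₂
  | @mul n r φ χ p hp _ _ ih ih' =>
    exact ih.right_of_surjective ih' (beta_add_right σ m n r) (isBraidedOp_iff.1 (hop p hp)).2
      (hmul φ χ p) TensorPower.mulEquiv.surjective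

theorem product_listTensor (p : R ⊗[k] R →ₗ[k] R) {m n : ℕ} (φ : ⨂[k]^m A →ₗ[k] R)
    (χ : ⨂[k]^n A →ₗ[k] R) {l l' : List A} (h : l.length = m) (h' : l'.length = n)
    (h'' : (l ++ l').length = m + n) :
    (p ∘ₗ TensorProduct.map φ χ ∘ₗ TensorPower.mulEquiv.symm.toLinearMap)
      (listTensor (m + n) (l ++ l') h'') = p (φ (listTensor m l h) ⊗ₜ χ (listTensor n l' h')) := by
  rw [← mulEquiv_listTensor l l' h h']
  simp

theorem comp_oneEquiv_symm_listTensor (x : A) (h : [x].length = 1) :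
    (ψ ∘ₗ oneEquiv.symm.toLinearMap) (listTensor 1 [x] h) = ψ x := by
  rw [LinearMap.comp_apply, ← oneEquiv_apply]
  simp

theorem PTree.shape_eq_leaf {X : Type u} {T : PTree X} : T.shape = .leaf ↔ T = .leaf :=
  not_iff_not.1 (PTree.map_ne_leaf _ T)

variable (pr su dt ψ) in
/-- The evaluation of decorated trees is multilinear in the decorations, and given by products. -/
theorem exists_isGenerated_eval (T : PTree Unit) (hT : T.Lush) (hl : T ≠ .leaf) :
    ∀ n, T.deg = n → ∃ φ, IsGenerated pr su dt ψ n φ ∧ ∀ s : PTree A, s.shape = T →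
      ∀ h : s.angles.length = n, φ (listTensor n s.angles h) = s.eval pr su dt ψ := by
  refine PTree.rec
    (motive_1 := fun T : PTree Unit => T.Lush → T ≠ .leaf → ∀ n, T.deg = n →
      ∃ φ, IsGenerated pr su dt ψ n φ ∧ ∀ s : PTree A, s.shape = T →
        ∀ h : s.angles.length = n, φ (listTensor n s.angles h) = s.eval pr su dt ψ)
    -- The chain ends in `x_k ≺ T`, so its motive also takes the rightmost branch `T`, with the
    -- claim for `T` as an assumption. Degrees are variables with equations, so that substitution
    -- replaces casts.
    (motive_2 := fun M : Mid Unit => M.Lush → ∀ T : PTree Unit,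
      (T ≠ .leaf → ∀ n, T.deg = n →
        ∃ φ, IsGenerated pr su dt ψ n φ ∧ ∀ s : PTree A, s.shape = T →
          ∀ h : s.angles.length = n, φ (listTensor n s.angles h) = s.eval pr su dt ψ) →
      ∀ n, 1 + (M.angles.length + T.deg) = n →
      ∃ φ, IsGenerated pr su dt ψ n φ ∧ ∀ (x : A) (N : Mid A) (t : PTree A),
        (N.map fun _ => ()) = M → t.shape = T → ∀ h : (x :: (N.angles ++ t.angles)).length = n,
          φ (listTensor n (x :: (N.angles ++ t.angles)) h) =
            N.eval pr su dt ψ x (rightAct pr t (t.eval pr su dt ψ))) ?_ ?_ ?_ ?_ T hT hl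
  · exact fun _ h => absurd rfl h
  · intro a _ M b ha hM hb hT _ n hn
    rw [PTree.Lush] at hT
    rw [PTree.deg, PTree.angles, List.length_append, List.length_cons, List.length_append] at hn
    obtain ⟨φ, hφ, h⟩ := hM hT.2.1 b (hb hT.2.2) _ rfl
    by_cases hl : a = .leaf
    · subst hl
      obtain rfl : 1 + (M.angles.length + b.deg) = n := by
        rw [← hn, PTree.deg, PTree.angles, List.length_nil]
        omega
      refine ⟨φ, hφ, fun s hs hlen => ?_⟩
      cases s with
      | leaf => cases hs
      | node a' x M' b' =>
        rw [PTree.shape, PTree.map] at hs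
        injection hs with h₁ h₂ h₃ h₄
        obtain rfl := PTree.shape_eq_leaf.1 h₁
        simp only [PTree.eval, PTree.angles, List.nil_append]
        exact h x M' b' h₃ h₄ _
    · obtain ⟨χ, hχ, h'⟩ := ha hT.1 hl _ rfl
      obtain rfl : a.deg + (1 + (M.angles.length + b.deg)) = n := by
        rw [← hn, PTree.deg, PTree.deg]
        omega
      refine ⟨_, hχ.mul (p := su) (by simp) hφ, fun s hs hlen => ?_⟩
      cases s with
      | leaf => cases hs
      | node a' x M' b' =>
        rw [PTree.shape, PTree.map] at hs
        injection hs with h₁ h₂ h₃ h₄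
        subst h₁ h₃ h₄
        simp only [PTree.angles]
        have hla : a'.angles.length = PTree.deg (a'.map fun _ => ()) := (PTree.deg_shape a').symm
        rw [PTree.angles, List.length_append] at hlen
        rw [product_listTensor su χ φ hla (by omega), h' a' rfl, h x M' b' rfl rfl,
          PTree.eval, leftAct_of_ne _ fun h => hl (PTree.shape_eq_leaf.2 h)]
  · intro _ T hT n hn
    by_cases hl : T = .leaf
    · subst hl
      obtain rfl : 1 = n := by simpa [Mid.angles, PTree.deg, PTree.angles] using hn
      refine ⟨_, .base, fun x N t hN ht hlen => ?_⟩
      obtain rfl := PTree.shape_eq_leaf.1 ht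
      cases N with
      | cons T z N => cases hN
      | nil =>
        simp only [Mid.angles, PTree.angles, List.nil_append, Mid.eval, rightAct_leaf]
        exact comp_oneEquiv_symm_listTensor x _
    · obtain ⟨χ, hχ, h'⟩ := hT hl _ rfl
      obtain rfl : 1 + T.deg = n := by simpa [Mid.angles] using hn
      refine ⟨_, IsGenerated.base.mul (p := pr) (by simp) hχ, fun x N t hN ht hlen => ?_⟩
      cases N with
      | cons T z N => cases hN
      | nil =>
        subst ht
        simp only [Mid.angles, List.nil_append, Mid.eval]
        rw [rightAct_of_ne _ fun h => hl (PTree.shape_eq_leaf.2 h),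
          ← h' t rfl (PTree.deg_shape t).symm]
        refine (product_listTensor (m := 1) (l := [x]) pr _ χ rfl (PTree.deg_shape t).symm
          hlen).trans ?_
        rw [comp_oneEquiv_symm_listTensor]
  · intro S _ M hS hM hl T hT n hn
    rw [Mid.Lush] at hl
    obtain ⟨φ, hφ, h⟩ := hM hl.2.2 T hT _ rfl
    obtain ⟨χ, hχ, h'⟩ := hS hl.2.1 hl.1 _ rfl
    obtain rfl : 1 + S.deg + (1 + (M.angles.length + T.deg)) = n := by
      rw [← hn, Mid.angles, List.length_append, List.length_cons, PTree.deg, PTree.deg]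
      omega
    refine ⟨_, (IsGenerated.base.mul (p := pr) (by simp) hχ).mul (p := dt) (by simp) hφ,
      fun x N t hN ht hlen => ?_⟩
    cases N with
    | nil => cases hN
    | cons S' z N =>
      rw [Mid.map] at hN
      injection hN with h₁ h₂ h₃
      subst h₁ h₃ ht
      have e : x :: ((Mid.cons S' z N).angles ++ t.angles) =
          ([x] ++ S'.angles) ++ (z :: (N.angles ++ t.angles)) := by
        simp [Mid.angles]
      have hS' : S'.angles.length = PTree.deg (S'.map fun _ => ()) := (PTree.deg_shape S').symm
      have hlx : ([x] ++ S'.angles).length = 1 + PTree.deg (S'.map fun _ => ()) := by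
        rw [List.length_append]
        exact congrArg (1 + ·) hS'
      have hlz : (z :: (N.angles ++ t.angles)).length =
          1 + ((N.map fun _ => ()).angles.length + t.shape.deg) := by
        rw [e, List.length_append] at hlen
        omega
      simp only [e]
      rw [product_listTensor dt _ φ hlx hlz, h z N t rfl rfl,
        product_listTensor (m := 1) pr _ χ (l := [x]) rfl hS', h' S' rfl, Mid.eval,
        comp_oneEquiv_symm_listTensor]

/-- The maps `φ` are the evaluations on single shapes, assembled over the direct sum. `evalMul`
supplies the products, and generation of each `φ T` by `ψ` supplies the braiding. -/
theorem exists_hom {μ : A ⊗[k] A →ₗ[k] A} {σ : A ⊗[k] A →ₗ[k] A ⊗[k] A}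
    {τ : R ⊗[k] R →ₗ[k] R ⊗[k] R} (hR : IsBraidedTridendriform pr su dt τ)
    (hψ : IsBraidedAlgebraHom μ σ dt τ ψ) :
    ∃ f : LushSpace k A →ₗ[k] R, IsBraidedTridendriformHom (prec μ) (succ μ) (dot μ) (braiding σ)
      pr su dt τ f ∧ f ∘ₗ emb k A = ψ := by
  choose φ hφ h using fun T : LushTree Unit =>
    exists_isGenerated_eval pr su dt ψ T.1 T.2.1 T.2.2 T.deg rfl
  let f : LushSpace k A →ₗ[k] R := DirectSum.toModule k _ _ φ
  have hf : ∀ T, f ∘ₗ incl k A T = φ T := fun T => LinearMap.ext fun x => by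
    simp [f, incl]
  have hmk : ∀ s : PTree A, s.Lush ∧ s ≠ .leaf → f (mkTree k s) = s.eval pr su dt ψ :=
    fun s hs => by
      rw [mkTree_val ⟨s, hs⟩, mk, ← LinearMap.comp_apply, hf]
      exact h _ s rfl _
  have hmul : ∀ x y, ψ (μ (x ⊗ₜ y)) = dt (ψ x ⊗ₜ ψ y) := fun x y => by
    simpa using LinearMap.congr_fun hψ.map_mul (x ⊗ₜ y)
  have heval : ∀ s t, EvalMul pr su dt ψ (fun a b => μ (a ⊗ₜ b)) s t :=
    evalMul hR.tridendriform hmul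
  have hop : ∀ (p : LushSpace k A ⊗[k] LushSpace k A →ₗ[k] LushSpace k A)
      (P : PTree A → PTree A → List (PTree A)) (q : R ⊗[k] R →ₗ[k] R), IsTreeProduct p P →
      (∀ s t, s ≠ .leaf → t ≠ .leaf → lsum (P s t) (PTree.eval pr su dt ψ) =
        q (s.eval pr su dt ψ ⊗ₜ t.eval pr su dt ψ)) → PreservesOp p q f := by
    intro p P q hp hq
    refine TensorProduct.ext' fun x y => ?_
    rw [LinearMap.comp_apply, LinearMap.comp_apply, TensorProduct.map_tmul]
    induction x using LushSpace.tree_induction with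
    | zero => simp
    | add x x' hx hx' => simp only [TensorProduct.add_tmul, map_add, hx, hx']
    | smul c x hx => simp only [← TensorProduct.smul_tmul', map_smul, hx]
    | tree s hs =>
    induction y using LushSpace.tree_induction with
    | zero => simp
    | add y y' hy hy' => simp only [TensorProduct.tmul_add, map_add, hy, hy']
    | smul c y hy => simp only [TensorProduct.tmul_smul, map_smul, hy]
    | tree t ht =>
      obtain ⟨h₁, h₂⟩ := hp s t hs ht
      rw [h₂, hmk s hs, hmk t ht, ← hq s t hs.2 ht.2, map_lsum]
      exact lsum_congr fun U hU => hmk U (h₁ U hU)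
  refine ⟨f, ⟨hop _ _ _ (isTreeProduct_prec μ) fun s t hs ht => ?_,
    hop _ _ _ (isTreeProduct_succ μ) fun s t hs ht => ?_,
    hop _ _ _ (isTreeProduct_dot μ) fun s t hs ht => ?_, ?_⟩, LinearMap.ext fun a => ?_⟩
  · cases s with
    | leaf => exact absurd rfl hs
    | node a x M b => exact (heval b t).precL hR.tridendriform ht
  · cases t with
    | leaf => exact absurd rfl ht
    | node c y N d => exact (heval s c).succL hR.tridendriform hs
  · cases s with
    | leaf => exact absurd rfl hs
    | node a x M b =>
      cases t with
      | leaf => exact absurd rfl ht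
      | node c y N d => exact (heval b c).dotL hR.tridendriform hmul
  · refine TensorProduct.ext' fun x y => ?_
    induction x using LushSpace.induction with
    | zero => simp
    | add x x' hx hx' => simp only [TensorProduct.add_tmul, map_add, hx, hx']
    | incl S x =>
    induction y using LushSpace.induction with
    | zero => simp
    | add y y' hy hy' => simp only [TensorProduct.tmul_add, map_add, hy, hy']
    | incl T y =>
      -- On a pair of summands the claim becomes the commutation of `φ S` and `φ T` with the
      -- crossings `beta` and `τ`.
      refine (braiding_incl σ S T).cancel_apply (f' := f) (q' := f) (β'' := τ) ?_ x y
      rw [hf, hf]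
      exact (hφ S).intertwines hψ.map_braiding hR.compat_prec hR.compat_succ hR.compat_dot (hφ T)
  · rw [LinearMap.comp_apply, emb_apply, ← mkTree_val, hmk _ (LushTree.single a).2]
    simp [LushTree.single, PTree.eval, Mid.eval]

/-- A lush tree is the value of itself at `emb`, so its image is its value in `R` at `f ∘ emb = ψ`,
which does not depend on `f`. -/
theorem hom_unique {μ : A ⊗[k] A →ₗ[k] A} {f : LushSpace k A →ₗ[k] R}
    (hp : PreservesOp (prec μ) pr f) (hs : PreservesOp (succ μ) su f)
    (hd : PreservesOp (dot μ) dt f) (hf : f ∘ₗ emb k A = ψ) {g : LushSpace k A →ₗ[k] R}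
    (hp' : PreservesOp (prec μ) pr g) (hs' : PreservesOp (succ μ) su g)
    (hd' : PreservesOp (dot μ) dt g) (hg : g ∘ₗ emb k A = ψ) : f = g := by
  refine LinearMap.ext fun x => ?_
  induction x using LushSpace.tree_induction with
  | zero => simp
  | add x y hx hy => rw [map_add, map_add, hx, hy]
  | smul c x hx => rw [map_smul, map_smul, hx]
  | tree s h =>
    have e : (fun a => f (emb k A a)) = fun a => g (emb k A a) :=
      congrArg DFunLike.coe (hf.trans hg.symm)
    rw [← eval_emb μ s h.1 h.2, PTree.map_eval hp hs hd, PTree.map_eval hp' hs' hd', e]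

end Extension

end BraidedTridend

theorem mainTheorem6 {k : Type u} [Field k] [CharZero k] {A : Type v} [AddCommGroup A] [Module k A]
    (μ : A ⊗[k] A →ₗ[k] A) (σ : A ⊗[k] A →ₗ[k] A ⊗[k] A)
    (hA : BraidedTridend.IsBraidedAlgebra μ σ) :
    BraidedTridend.IsBraidedTridendriform (BraidedTridend.prec μ) (BraidedTridend.succ μ)
      (BraidedTridend.dot μ) (BraidedTridend.braiding σ) ∧
    Function.Injective (BraidedTridend.emb k A) ∧
    BraidedTridend.IsBraidedAlgebraHom μ σ (BraidedTridend.dot μ) (BraidedTridend.braiding σ)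
      (BraidedTridend.emb k A) ∧
    ∀ (R : Type w) [AddCommGroup R] [Module k R] (precR succR dotR : R ⊗[k] R →ₗ[k] R)
      (τ : R ⊗[k] R →ₗ[k] R ⊗[k] R),
      BraidedTridend.IsBraidedTridendriform precR succR dotR τ →
      ∀ ψ : A →ₗ[k] R, BraidedTridend.IsBraidedAlgebraHom μ σ dotR τ ψ →
        ∃! ψhat : BraidedTridend.LushSpace k A →ₗ[k] R,
          BraidedTridend.IsBraidedTridendriformHom (BraidedTridend.prec μ) (BraidedTridend.succ μ)
            (BraidedTridend.dot μ) (BraidedTridend.braiding σ) precR succR dotR τ ψhat ∧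
          ψhat ∘ₗ BraidedTridend.emb k A = ψ := by
  refine ⟨BraidedTridend.isBraidedTridendriform hA, BraidedTridend.emb_injective,
    ⟨BraidedTridend.preservesOp_emb μ, BraidedTridend.preservesBraiding_emb σ⟩, ?_⟩
  intro R _ _ precR succR dotR τ hR ψ hψ
  obtain ⟨f, hf, hfe⟩ := BraidedTridend.exists_hom hR hψ
  exact ⟨f, ⟨hf, hfe⟩, fun g hg => BraidedTridend.hom_unique hg.1.map_prec hg.1.map_succ
    hg.1.map_dot hg.2 hf.map_prec hf.map_succ hf.map_dot hfe⟩
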